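/- Let $d\ge 1$. Let $\Omega$ be the set of Lebesgue measurable maps $\mathbf a$ from $\mathbb R^d$ into the symmetric positive definite $d\times d$ matrices such that $\sup_{x\in U}(|\mathbf a(x)|+|\mathbf a(x)^{-1}|)<\infty$ for every bounded $U\subset\mathbb R^d$, where $|A|$ is the Euclidean operator norm. For Borel $U\subseteq\mathbb R^d$ let $\mathcal F_U$ be the $\sigma$-algebra on $\Omega$ generated by the maps $\mathbf a\mapsto\int e_i\cdot\mathbf a(x)e_j\,\varphi(x)\,dx$ with $\varphi\in C_c^\infty(U)$ and $1\le i,j\le d$, and let $\mathcal F=\mathcal F_{\mathbb R^d}$. Let $r\in(0,1)$ and let $\mathbb P$ be a probability measure on $(\Omega,\mathcal F)$ such that * $\mathbb P[T_zA]=\mathbb P[A]$ for all $z\in\mathbb Z^d$ and $A\in\mathcal F$, where $(T_z\mathbf a)(x)=\mathbf a(x+z)$; * for all Borel $U,V$ at $\ell^\infty$-distance at least $1$, every square-integrable $\mathcal F_U$-measurable $f$ and every square-integrable $\mathcal F_V$-measurable $g$ of nonzero variance have correlation $\mathrm{Cov}[f,g]/(\mathrm{Var}[f]^{1/2}\mathrm{Var}[g]^{1/2})\le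 r$. Let $\square_n=(-\tfrac12 3^n,\tfrac12 3^n)^d$, $l_p(x)=p\cdot x$. For a cube $U$ put $$\Lambda(U)=\operatorname*{ess\,sup}_{x\in U}\sup_{|\xi|=1}\xi\cdot\mathbf a(x)\xi,\qquad \lambda(U)=\operatorname*{ess\,inf}_{x\in U}\inf_{|\xi|=1}\xi\cdot\mathbf a(x)\xi,$$ $$\mu(U,p)=\inf_{v\in l_p+H_0^1(U)}|U|^{-1}\int_U\tfrac12\nabla v\cdot\mathbf a\nabla v ,$$ let $v(\cdot,U,p)$ be the minimizer in $l_p+H^1_0(U)$, and let $\mathbf a(U)$ be the symmetric matrix with $\mu(U,p)=\tfrac12 p\cdot\mathbf a(U)p$ for all $p\in\mathbb R^d$. Suppose that $\bar\mu(p)=\lim_{m\to\infty}\mathbb E[\mu(\square_m,p)]=\inf_m\mathbb E[\mu(\square_m,p)]$ is finite for every $p$, and let $\bar{\mathbf a}$ be the homogenized matrix, i.e. the symmetric matrix with $\bar\mu(p)=\tfrac12p\cdot\bar{\mathbf a}p$ for all $p\in\mathbb R^d$. Define $$\Omega(n)=\Bigl(\sum_{m=0}^n3^{-(n-m)}\Bigl(3^{-(n-m)d}\sum_{z\in3^m\mathbb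 Z^d\cap\square_n}|\mathbf a(z+\square_m)-\bar{\mathbf a}|\Bigr)^{1/2}\Bigr)^2 .$$ For a vector field $F\in L^2(U;\mathbb R^d)$ let $$\|F\|_{\widehat{\underline H}^{-1}(U)}=\sup\Bigl\{|U|^{-1}\int_U F\cdot\Psi:\ \Psi\in H^1(U;\mathbb R^d),\ |U|^{-1/d}\Bigl(|U|^{-1}\int_U|\Psi|^2\Bigr)^{1/2}+\Bigl(|U|^{-1}\int_U|\nabla\Psi|^2\Bigr)^{1/2}\le1\Bigr\},$$ with $|\nabla\Psi|$ the Euclidean (Frobenius) norm. **Proposition.** There exists a constant $C=C(d)<\infty$, depending only on $d$, such that for every such $r$ and $\mathbb P$, every $\mathbf a\in\Omega$, every $n\in\{0,1,2,\dots\}$ and every $p\in\mathbb R^d$ with $|p|<1$, $$\|\nabla v(\cdot,\square_n,p)-p\|_{\widehat{\underline H}^{-1}(\square_n)}^2\le C\,\frac{\Lambda(\square_n)}{\lambda(\square_n)}+C\,3^{2n}\frac1{\lambda(\square_n)}\Omega(n)$$ and $$\|\mathbf a\nabla v(\cdot,\square_n,p)-\bar{\mathbf a}p\|_{\widehat{\underline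 H}^{-1}(\square_n)}^2\le C\Bigl(\frac{\Lambda(\square_n)^3}{\lambda(\square_n)}+|\bar{\mathbf a}|^2\Bigr)+C\,3^{2n}\Bigl(\frac{\Lambda(\square_n)^2}{\lambda(\square_n)}+|\bar{\mathbf a}|\Bigr)\Omega(n).$$ -/

import Mathlib

open MeasureTheory ProbabilityTheory Filter Topology
open scoped ENNReal ContDiff

namespace StochHom

/-- Euclidean space `ℝ^d`. -/
abbrev E (d : ℕ) : Type := EuclideanSpace ℝ (Fin d)

/-- Real `d × d` matrices. -/
abbrev Mat (d : ℕ) : Type := Matrix (Fin d) (Fin d) ℝ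

noncomputable section

variable {d : ℕ}

/-- The matrix-vector product `A x`. -/
def app (A : Mat d) (x : E d) : E d := Matrix.toEuclideanCLM (n := Fin d) (𝕜 := ℝ) A x

/-- The bilinear expression `x · A y`. -/
def form (A : Mat d) (x y : E d) : ℝ := inner ℝ x (app A y)

/-- The operator norm `|A| = sup_{|ξ| = 1} |A ξ|` with respect to the Euclidean norm. -/
def opNorm (A : Mat d) : ℝ := ‖Matrix.toEuclideanCLM (n := Fin d) (𝕜 := ℝ) A‖

/-- The `i`-th vector of the canonical basis. -/
def basisVec (i : Fin d) : E d := EuclideanSpace.single i 1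

/-- The triadic cube `z + □_n = z + (-3^n/2, 3^n/2)^d`. -/
def cube (z : E d) (n : ℕ) : Set (E d) := {x | ∀ i, |x i - z i| < 3 ^ n / 2}

/-- The lattice point `3^m k`, for `k ∈ ℤ^d`. -/
def latticePt (m : ℕ) (k : Fin d → ℤ) : E d := WithLp.toLp 2 fun i => (3 : ℝ) ^ m * (k i : ℝ)

/-- The integer vectors `k` with `3^m k ∈ □_n` (for `m ≤ n`, see `mem_subcubes`): they index the
`3^((n-m)d)` points of `3^m ℤ^d ∩ □_n`, which are the centres of the subcubes `z + □_m` of `□_n`. -/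
def subcubes (d n m : ℕ) : Finset (Fin d → ℤ) :=
  Fintype.piFinset fun _ => Finset.Icc (-((3 ^ (n - m) - 1) / 2)) ((3 ^ (n - m) - 1) / 2)

theorem mem_subcubes {n m : ℕ} (h : m ≤ n) (k : Fin d → ℤ) :
    k ∈ subcubes d n m ↔ latticePt m k ∈ cube 0 n := by
  obtain ⟨j, rfl⟩ := Nat.exists_eq_add_of_le h
  have hodd : Odd ((3 : ℤ) ^ j) := Odd.pow (by decide)
  obtain ⟨t, ht⟩ := hodd
  have hm : (0 : ℝ) < 3 ^ m := by positivity
  have ht' : (3 : ℝ) ^ j = 2 * t + 1 := by exact_mod_cast ht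
  simp only [subcubes, Fintype.mem_piFinset, Finset.mem_Icc, cube, Set.mem_ofPred_eq, latticePt,
    Nat.add_sub_cancel_left, ht]
  refine forall_congr' fun i => ?_
  have e : (2 * t + 1 - 1) / 2 = t := by omega
  rw [e]
  have hz : ((0 : E d) i) = 0 := rfl
  rw [hz, sub_zero, abs_mul, abs_of_pos hm, pow_add, mul_div_assoc, mul_lt_mul_iff_right₀ hm, ht']
  rw [← abs_le]
  constructor
  · intro hk
    have : |(k i : ℝ)| ≤ t := by exact_mod_cast hk
    linarith
  · intro hk
    have : (2 : ℝ) * |(k i : ℝ)| < 2 * t + 1 := by linarith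
    have : 2 * |k i| < 2 * t + 1 := by exact_mod_cast this
    omega

/-! ### Coefficient fields -/

/-- A coefficient field: a Lebesgue measurable map into the symmetric positive definite matrices
such that `|a|` and `|a⁻¹|` are bounded on every bounded set. -/
def IsCoeffField (a : E d → Mat d) : Prop :=
  (∀ i j, AEMeasurable (fun x => a x i j) volume) ∧
  (∀ x, (a x).PosDef) ∧
  ∀ U : Set (E d), Bornology.IsBounded U →
    ∃ K : ℝ, ∀ x ∈ U, opNorm (a x) + opNorm ((a x)⁻¹) ≤ K

/-- The space of all coefficient fields, on which the random field is modelled. -/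
def CoeffField (d : ℕ) : Type := {a : E d → Mat d // IsCoeffField a}

instance : CoeFun (CoeffField d) (fun _ => E d → Mat d) := ⟨Subtype.val⟩

/-- `φ ∈ C_c^∞(U)`. -/
def IsTest (U : Set (E d)) (φ : E d → ℝ) : Prop :=
  ContDiff ℝ ∞ φ ∧ HasCompactSupport φ ∧ tsupport φ ⊆ U

/-- The `σ`-algebra `F_U` generated by the maps `a ↦ ∫ e_i · a(x) e_j φ(x) dx` for
`φ ∈ C_c^∞(U)`. -/
abbrev sigmaOn (U : Set (E d)) : MeasurableSpace (CoeffField d) :=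
  ⨆ (i : Fin d) (j : Fin d) (φ : {φ : E d → ℝ // IsTest U φ}),
    (borel ℝ).comap fun a : CoeffField d =>
      ∫ x, form (a x) (basisVec i) (basisVec j) * φ.1 x

/-- The full `σ`-algebra `F = F_{ℝ^d}`. -/
instance : MeasurableSpace (CoeffField d) := sigmaOn Set.univ

/-- The translation `(T_y a)(x) = a(x + y)`. -/
def shift (y : E d) (a : CoeffField d) : CoeffField d :=
  ⟨fun x => a.1 (x + y), by
    obtain ⟨h1, h2, h3⟩ := a.2
    refine ⟨fun i j => ?_, fun x => h2 _, fun U hU => ?_⟩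
    · exact (h1 i j).comp_quasiMeasurePreserving
        (measurePreserving_add_right volume y).quasiMeasurePreserving
    · have hb : Bornology.IsBounded ((fun x => x + y) '' U) :=
        (isometry_add_right y).lipschitz.isBounded_image hU
      obtain ⟨K, hK⟩ := h3 _ hb
      exact ⟨K, fun x hx => hK _ (Set.mem_image_of_mem _ hx)⟩⟩

/-- Stationarity with respect to `ℤ^d`-translations: `P[T_z A] = P[A]`. -/
def IsStationary (P : Measure (CoeffField d)) : Prop :=
  ∀ (z : Fin d → ℤ) (A : Set (CoeffField d)), MeasurableSet A →
    P (shift (latticePt 0 z) '' A) = P A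

/-- The maximal correlation of `F_U` and `F_V` is at most `r` whenever the Borel sets `U`, `V` have
`ℓ^∞`-distance at least `1`. -/
def IsMixing (r : ℝ) (P : Measure (CoeffField d)) : Prop :=
  ∀ U V : Set (E d), MeasurableSet U → MeasurableSet V →
    (∀ u ∈ U, ∀ v ∈ V, ∃ i, 1 ≤ |u i - v i|) →
    ∀ f g : CoeffField d → ℝ,
      Measurable[sigmaOn U] f → MemLp f 2 P → Measurable[sigmaOn V] g → MemLp g 2 P →
      covariance f g P / (Real.sqrt (variance f P) * Real.sqrt (variance g P)) ≤ r

/-- `Λ(U)`, the essential supremum over `U` of the largest eigenvalue of the coefficients. -/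
def ellSup (a : E d → Mat d) (U : Set (E d)) : ℝ :=
  essSup (fun x => ⨆ ξ : Metric.sphere (0 : E d) 1, form (a x) ξ.1 ξ.1) (volume.restrict U)

/-- `λ(U)`, the essential infimum over `U` of the smallest eigenvalue of the coefficients. -/
def ellInf (a : E d → Mat d) (U : Set (E d)) : ℝ :=
  essInf (fun x => ⨅ ξ : Metric.sphere (0 : E d) 1, form (a x) ξ.1 ξ.1) (volume.restrict U)

/-! ### Sobolev spaces -/

/-- `u ∈ H^1(U)` with weak gradient `G` in `U`. -/
def IsH1 (U : Set (E d)) (u : E d → ℝ) (G : E d → E d) : Prop :=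
  MemLp u 2 (volume.restrict U) ∧ MemLp G 2 (volume.restrict U) ∧
  ∀ φ : E d → ℝ, IsTest U φ → ∀ i : Fin d,
    ∫ x in U, u x * fderiv ℝ φ x (basisVec i) = - ∫ x in U, G x i * φ x

/-- `u ∈ H_0^1(U)` with weak gradient `G`: `u` is a limit of functions of `C_c^∞(U)` in
`H^1(U)`. -/
def IsH10 (U : Set (E d)) (u : E d → ℝ) (G : E d → E d) : Prop :=
  IsH1 U u G ∧ ∃ φ : ℕ → E d → ℝ, (∀ k, IsTest U (φ k)) ∧
    Tendsto (fun k => eLpNorm (fun x => u x - φ k x) 2 (volume.restrict U)) atTop (𝓝 0) ∧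
    Tendsto (fun k => eLpNorm (fun x => G x - gradient (φ k) x) 2 (volume.restrict U))
      atTop (𝓝 0)

/-- The normalized norm `(⨍_U f^2)^(1/2)`. -/
def normL2 (U : Set (E d)) (f : E d → ℝ) : ℝ := Real.sqrt (⨍ x in U, f x ^ 2)

/-- The normalized norm `|U|^(-1/d) (⨍_U |Ψ|^2)^(1/2) + (⨍_U |∇Ψ|^2)^(1/2)` of a vector field `Ψ`
in `H^1(U; ℝ^d)`, where `D i` is the weak gradient of the `i`-th component of `Ψ`. -/
def normH1 (U : Set (E d)) (Ψ : E d → E d) (D : Fin d → E d → E d) : ℝ :=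
  (volume U).toReal ^ (-(1 / (d : ℝ))) * normL2 U (fun x => ‖Ψ x‖) +
    normL2 U (fun x => Real.sqrt (∑ i, ‖D i x‖ ^ 2))

/-- The normalized dual norm of a vector field `F`: the supremum of `⨍_U F · Ψ` over all
`Ψ ∈ H^1(U; ℝ^d)` (no boundary condition) with normalized `H^1` norm at most `1`. The supremum is
taken in `[0, ∞]`; this changes nothing as `Ψ` may be replaced by `-Ψ`. -/
def normHhat (U : Set (E d)) (F : E d → E d) : ℝ≥0∞ :=
  ⨆ (Ψ : E d → E d) (D : Fin d → E d → E d) (_ : ∀ i, IsH1 U (fun x => Ψ x i) (D i))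
    (_ : normH1 U Ψ D ≤ 1), ENNReal.ofReal (⨍ x in U, inner ℝ (F x) (Ψ x))

/-! ### The energy, its minimizer and the matrices `a(U)` and `ā` -/

/-- The energy `⨍_U ½ G · a G` of a gradient field `G`. -/
def energy (a : E d → Mat d) (U : Set (E d)) (G : E d → E d) : ℝ :=
  ⨍ x in U, (1 / 2) * form (a x) (G x) (G x)

/-- `v ∈ l_p + H_0^1(U)` with weak gradient `G`, where `l_p(x) = p · x`. -/
def IsAdmissible (U : Set (E d)) (p : E d) (v : E d → ℝ) (G : E d → E d) : Prop :=
  IsH10 U (fun x => v x - inner ℝ p x) (fun x => G x - p)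

/-- `μ(U, p) = inf_{v ∈ l_p + H_0^1(U)} ⨍_U ½ ∇v · a ∇v`. -/
def mu (a : E d → Mat d) (U : Set (E d)) (p : E d) : ℝ :=
  sInf {t : ℝ | ∃ v G, IsAdmissible U p v G ∧ t = energy a U G}

/-- `v`, with weak gradient `G`, minimizes the energy in `l_p + H_0^1(U)`. -/
def IsMinimizer (a : E d → Mat d) (U : Set (E d)) (p : E d) (v : E d → ℝ) (G : E d → E d) :
    Prop :=
  IsAdmissible U p v G ∧ ∀ w H, IsAdmissible U p w H → energy a U G ≤ energy a U H

/-- The symmetric matrix `A` with `Q(p) = ½ p · A p` for a quadratic form `Q`, by polarization. -/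
def quadMatrix (Q : E d → ℝ) : Mat d :=
  Matrix.of fun i j => Q (basisVec i + basisVec j) - Q (basisVec i) - Q (basisVec j)

theorem form_basisVec (A : Mat d) (i j : Fin d) : form A (basisVec i) (basisVec j) = A i j := by
  simp [form, app, basisVec, EuclideanSpace.inner_single_left]

theorem quadMatrix_eq {Q : E d → ℝ} {A : Mat d} (hA : A.IsSymm)
    (hQ : ∀ p, Q p = 1 / 2 * form A p p) : quadMatrix Q = A := by
  ext i j
  have h : form A (basisVec i + basisVec j) (basisVec i + basisVec j) =
      A i i + A i j + (A j i + A j j) := by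
    simp only [← form_basisVec, form, app, map_add, inner_add_left, inner_add_right]
    ring
  simp only [quadMatrix, Matrix.of_apply, hQ, h, form_basisVec]
  rw [hA.apply i j]
  ring

/-- `a(U)`, the symmetric matrix with `μ(U, p) = ½ p · a(U) p` for every `p`. -/
def coarse (a : E d → Mat d) (U : Set (E d)) : Mat d := quadMatrix (mu a U)

/-- `μ̄(p) = lim_m E[μ(□_m, p)] = inf_m E[μ(□_m, p)]`. The limit and the infimum agree since these
expectations are nonincreasing in `m` under stationarity. -/
def muBar (P : Measure (CoeffField d)) (p : E d) : ℝ≥0∞ :=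
  ⨅ m : ℕ, ∫⁻ a : CoeffField d, ENNReal.ofReal (mu a (cube 0 m) p) ∂P

/-- `abar` is the homogenized matrix `ā`, i.e. the symmetric matrix with `μ̄(p) = ½ p · ā p` for
every `p`; in particular `μ̄` is finite. -/
def IsHomogenized (P : Measure (CoeffField d)) (abar : Mat d) : Prop :=
  abar.IsSymm ∧ ∀ p : E d, muBar P p ≠ ⊤ ∧ (muBar P p).toReal = 1 / 2 * form abar p p

/-- The random variable
`(∑_{m=0}^n 3^{-(n-m)} (3^{-(n-m)d} ∑_{z ∈ 3^m ℤ^d ∩ □_n} |a(z + □_m) - ā|)^{1/2})^2`. -/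
def defect (a : E d → Mat d) (abar : Mat d) (n : ℕ) : ℝ :=
  (∑ m ∈ Finset.range (n + 1), ((3 : ℝ) ^ (n - m))⁻¹ *
    Real.sqrt (((3 : ℝ) ^ ((n - m) * d))⁻¹ *
      ∑ k ∈ subcubes d n m, opNorm (coarse a (cube (latticePt m k) m) - abar))) ^ 2

end

end StochHom

open StochHom

/-! Fix a coefficient field and let `v` be the minimizer in `□_n` with slope `p`. Two ingredients
give the estimate: a multiscale Poincaré inequality, which bounds the dual norm of a field by its
means over triadic subcubes, and an energy identity, which bounds those means for `∇v - p` and `a∇v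
- ā p` by the distances `|a(z + □_m) - ā|`.

Multiscale Poincaré (`normHhat_le`). In `∫ F · Ψ`, replace `F` and `Ψ` by their means on cubes of
size `3^m`, and pass from scale `0` to scale `n` by a telescoping sum. Each change of scale pairs
the means of `F` on the small cubes with oscillations of `Ψ` on cubes of size `3^(m+1)`, and the
Poincaré inequality gives a factor `3^(m+1) ‖∇Ψ‖`. Hence the dual norm of `F` is at most a constant
times `‖F‖_{L²} + ∑_m 3^m (mean over z of |⨍_{z+□_m} F|²)^(1/2)`.

Energy identity (`sum_integral_form_sub_le`). Let `v_z` be the minimizer in `z + □_m` with the same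
slope `p`. The flux `a∇v` stays divergence free in the subcube and `∇v_z - p` is a limit of
gradients of test functions, so the cross term `∫ ∇v_z · a∇v` equals `∫ p · a∇v`. Summing over `z`,
the energy of `∇v - ∇v_z` is exactly `∑_z |□_m| p · a(z+□_m) p - |□_n| p · a(□_n) p`. Inserting `ā`
bounds this by the mean distances at scales `m` and `n`.

Since `∇v_z` has mean `p`, the mean of `∇v - p` over `z + □_m` is that of `∇v - ∇v_z`, which the
energy controls with a factor `1/λ`. Since `a∇v_z` has mean `a(z+□_m) p`, the flux has the
additional error `(a(z+□_m) - ā) p`. The weights `3^m = 3^n 3^(-(n-m))` then reproduce the sum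
defining `Ω(n)`, while the crude `L²` bounds on the fields give the terms without `Ω(n)`.

The minimizers are handled through their gradients, in the closure in `L²` of the gradients of test
functions; Lax–Milgram there gives a solution linear in `p`. -/

namespace StochHom

noncomputable section

variable {d : ℕ}

/-! ### Triadic cubes -/

theorem cube_eq_preimage (z : E d) (n : ℕ) :
    cube z n = (WithLp.ofLp : E d → Fin d → ℝ) ⁻¹'
      (Set.univ.pi fun i => Set.Ioo (z i - 3 ^ n / 2) (z i + 3 ^ n / 2)) := by
  ext x
  simp only [cube, Set.mem_ofPred_eq, Set.mem_preimage, Set.mem_pi, Set.mem_univ, true_imp_iff,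
    Set.mem_Ioo, abs_lt]
  exact forall_congr' fun i => ⟨fun h => ⟨by linarith, by linarith⟩,
    fun h => ⟨by linarith, by linarith⟩⟩

theorem isOpen_cube (z : E d) (n : ℕ) : IsOpen (cube z n) := by
  rw [cube_eq_preimage]
  exact (isOpen_set_pi Set.finite_univ fun _ _ => isOpen_Ioo).preimage
    (PiLp.continuous_ofLp 2 _)

theorem measurableSet_cube (z : E d) (n : ℕ) : MeasurableSet (cube z n) :=
  (isOpen_cube z n).measurableSet

theorem convex_cube (z : E d) (n : ℕ) : Convex ℝ (cube z n) := by
  intro x hx y hy s t hs ht hst i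
  have h1 := abs_lt.1 (hx i)
  have h2 := abs_lt.1 (hy i)
  have e : (s • x + t • y) i - z i = s * (x i - z i) + t * (y i - z i) := by
    simp only [PiLp.add_apply, PiLp.smul_apply, smul_eq_mul]
    linear_combination (z i) * hst
  rw [e, abs_lt]
  constructor <;> rcases hs.eq_or_lt with rfl | hs' <;> nlinarith

theorem volume_cube (z : E d) (n : ℕ) : volume (cube z n) = ENNReal.ofReal ((3 ^ n) ^ d) := by
  rw [cube_eq_preimage, (PiLp.volume_preserving_ofLp (Fin d)).measure_preimage
    (MeasurableSet.univ_pi fun _ => measurableSet_Ioo).nullMeasurableSet, Real.volume_pi_Ioo]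
  have e : ∀ i, z i + 3 ^ n / 2 - (z i - 3 ^ n / 2) = (3 : ℝ) ^ n := fun i => by ring
  simp only [e, Finset.prod_const, Finset.card_univ, Fintype.card_fin]
  rw [ENNReal.ofReal_pow (p := (3 : ℝ) ^ n) (by positivity)]

theorem volume_cube_toReal (z : E d) (n : ℕ) : (volume (cube z n)).toReal = (3 ^ n) ^ d := by
  rw [volume_cube, ENNReal.toReal_ofReal (by positivity)]

theorem real_cube (z : E d) (n : ℕ) : volume.real (cube z n) = (3 ^ n) ^ d :=
  volume_cube_toReal z n

instance isFiniteMeasure_cube (z : E d) (n : ℕ) :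
    IsFiniteMeasure (volume.restrict (cube z n)) :=
  ⟨by rw [Measure.restrict_apply_univ, volume_cube]; exact ENNReal.ofReal_lt_top⟩

theorem abs_sub_lt_of_mem_cube {z x y : E d} {n : ℕ} (hx : x ∈ cube z n) (hy : y ∈ cube z n)
    (i : Fin d) : |x i - y i| < 3 ^ n := by
  have h1 := abs_lt.1 (hx i)
  have h2 := abs_lt.1 (hy i)
  rw [abs_lt]; constructor <;> linarith

theorem isBounded_cube (z : E d) (n : ℕ) : Bornology.IsBounded (cube z n) := by
  rw [cube_eq_preimage]
  exact (EuclideanSpace.equiv (Fin d) ℝ).antilipschitz.isBounded_preimage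
    (Bornology.IsBounded.pi fun i => Metric.isBounded_Ioo _ _)

/-! ### Subdivision into triadic subcubes -/

theorem latticePt_apply (m : ℕ) (k : Fin d → ℤ) (i : Fin d) :
    latticePt m k i = 3 ^ m * (k i : ℝ) := rfl

theorem mem_subcubes_add {m j : ℕ} {k : Fin d → ℤ} :
    k ∈ subcubes d (m + j) m ↔ ∀ i, -3 ^ j < 2 * k i ∧ 2 * k i < 3 ^ j := by
  obtain ⟨t, ht⟩ : Odd ((3 : ℤ) ^ j) := Odd.pow (by decide)
  simp only [subcubes, Fintype.mem_piFinset, Finset.mem_Icc, Nat.add_sub_cancel_left, ht]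
  refine forall_congr' fun i => ?_
  omega

theorem card_subcubes {n m : ℕ} (h : m ≤ n) :
    ((subcubes d n m).card : ℝ) = 3 ^ ((n - m) * d) := by
  obtain ⟨j, rfl⟩ := Nat.exists_eq_add_of_le h
  obtain ⟨t, ht⟩ : Odd ((3 : ℕ) ^ j) := Odd.pow (by decide)
  have ht' : (3 : ℤ) ^ j = 2 * t + 1 := by exact_mod_cast ht
  have : (subcubes d (m + j) m).card = 3 ^ (j * d) := by
    simp only [subcubes, Fintype.card_piFinset, Int.card_Icc, Finset.prod_const,
      Finset.card_univ, Fintype.card_fin, Nat.add_sub_cancel_left, pow_mul, ht, ht']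
    congr 1
    omega
  rw [this, Nat.add_sub_cancel_left]
  push_cast
  rfl

theorem subcube_subset {n m : ℕ} (h : m ≤ n) (z : E d) {k : Fin d → ℤ} (hk : k ∈ subcubes d n m) :
    cube (z + latticePt m k) m ⊆ cube z n := by
  obtain ⟨j, rfl⟩ := Nat.exists_eq_add_of_le h
  rw [mem_subcubes_add] at hk
  intro x hx i
  have h1 := hx i
  have h2 : 2 * |k i| + 1 ≤ 3 ^ j := by
    have := hk i
    rcases abs_cases (k i) with h | h <;> omega
  have h3 : 2 * |(k i : ℝ)| + 1 ≤ 3 ^ j := by exact_mod_cast h2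
  have hm : (0 : ℝ) < 3 ^ m := by positivity
  rw [PiLp.add_apply, latticePt_apply] at h1
  calc |x i - z i| = |(x i - (z i + 3 ^ m * (k i : ℝ))) + 3 ^ m * (k i : ℝ)| := by congr 1; ring
    _ ≤ |x i - (z i + 3 ^ m * (k i : ℝ))| + |3 ^ m * (k i : ℝ)| := abs_add_le _ _
    _ < 3 ^ m / 2 + 3 ^ m * |(k i : ℝ)| := by
        rw [abs_mul, abs_of_pos hm]; linarith
    _ ≤ 3 ^ (m + j) / 2 := by rw [pow_add]; nlinarith

theorem disjoint_subcubes (m : ℕ) (z : E d) {k l : Fin d → ℤ} (hkl : k ≠ l) :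
    Disjoint (cube (z + latticePt m k) m) (cube (z + latticePt m l) m) := by
  rw [Set.disjoint_left]
  intro x hx hy
  apply hkl
  funext i
  have h1 := abs_lt.1 (hx i)
  have h2 := abs_lt.1 (hy i)
  simp only [PiLp.add_apply, latticePt_apply] at h1 h2
  have hm : (0 : ℝ) < 3 ^ m := by positivity
  have h3 : (3 : ℝ) ^ m * ((k i : ℝ) - l i) < 3 ^ m * 1 := by linarith
  have h4 : (3 : ℝ) ^ m * ((l i : ℝ) - k i) < 3 ^ m * 1 := by linarith
  have h5 := lt_of_mul_lt_mul_left h3 hm.le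
  have h6 := lt_of_mul_lt_mul_left h4 hm.le
  have h7 : k i - l i < 1 := by exact_mod_cast h5
  have h8 : l i - k i < 1 := by exact_mod_cast h6
  omega

/-- The subcubes are disjoint, lie in the large cube and have the same total volume, so the
uncovered faces form a null set and need no description. -/
theorem iUnion_subcubes_ae_eq {n m : ℕ} (h : m ≤ n) (z : E d) :
    (⋃ k ∈ subcubes d n m, cube (z + latticePt m k) m) =ᵐ[volume] cube z n := by
  refine ae_eq_of_subset_of_measure_ge (Set.iUnion₂_subset fun k hk => subcube_subset h z hk) ?_
    (Finset.measurableSet_biUnion _ fun k _ => measurableSet_cube _ _).nullMeasurableSet ?_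
  · rw [measure_biUnion_finset (fun k _ l _ hkl => disjoint_subcubes m z hkl)
      fun k _ => measurableSet_cube _ _]
    simp only [volume_cube, Finset.sum_const, nsmul_eq_mul]
    rw [← ENNReal.ofReal_natCast, card_subcubes h, ← ENNReal.ofReal_mul (by positivity)]
    refine ENNReal.ofReal_le_ofReal (le_of_eq ?_)
    obtain ⟨j, rfl⟩ := Nat.exists_eq_add_of_le h
    rw [Nat.add_sub_cancel_left, pow_mul, ← mul_pow, pow_add, mul_comm]
  · rw [volume_cube]; exact ENNReal.ofReal_ne_top

theorem integral_cube_eq_sum {F : Type*} [NormedAddCommGroup F] [NormedSpace ℝ F] {n m : ℕ}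
    (h : m ≤ n) (z : E d) {f : E d → F} (hf : IntegrableOn f (cube z n)) :
    ∫ x in cube z n, f x =
      ∑ k ∈ subcubes d n m, ∫ x in cube (z + latticePt m k) m, f x := by
  rw [← setIntegral_congr_set (iUnion_subcubes_ae_eq h z)]
  exact integral_biUnion_finset _ (fun k _ => measurableSet_cube _ _)
    (fun k _ l _ hkl => disjoint_subcubes m z hkl)
    fun k hk => hf.mono_set (subcube_subset h z hk)

/-- Groups the subcubes by their parents one scale up: the last digit of `k` in balanced ternary,
with digits `-1, 0, 1`, locates a child in its parent. -/
theorem sum_subcubes_succ {M : Type*} [AddCommMonoid M] {n m : ℕ} (h : m + 1 ≤ n)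
    (f : (Fin d → ℤ) → M) :
    ∑ k ∈ subcubes d n m, f k =
      ∑ l ∈ subcubes d n (m + 1), ∑ j ∈ subcubes d (m + 1) m, f (fun i => 3 * l i + j i) := by
  obtain ⟨r, rfl⟩ := Nat.exists_eq_add_of_le h
  rw [← Finset.sum_product']
  obtain ⟨t, ht⟩ : Odd ((3 : ℤ) ^ r) := Odd.pow (by decide)
  have ht1 : (3 : ℤ) ^ (1 + r) = 6 * t + 3 := by rw [pow_add, ht]; ring
  rw [add_assoc]
  -- Floor division of `k i + 1` by `3` rounds `k i / 3` to the nearest integer, so the remainder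
  -- lies in `{-1, 0, 1}`.
  refine Finset.sum_nbij' (fun k => (fun i => (k i + 1) / 3, fun i => k i - 3 * ((k i + 1) / 3)))
    (fun q i => 3 * q.1 i + q.2 i) ?_ ?_ ?_ ?_ ?_
  · intro k hk
    rw [mem_subcubes_add] at hk
    rw [Finset.mem_product, ← add_assoc, mem_subcubes_add, mem_subcubes_add]
    refine ⟨fun i => ?_, fun i => ?_⟩
    · have := hk i
      simp only [ht1, ht] at this ⊢
      omega
    · dsimp only
      omega
  · rintro ⟨l, j⟩ hq
    rw [Finset.mem_product, ← add_assoc, mem_subcubes_add, mem_subcubes_add] at hq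
    rw [mem_subcubes_add]
    intro i
    have h1 := hq.1 i
    have h2 := hq.2 i
    simp only [ht1, ht] at h1 h2 ⊢
    omega
  · intro k _
    funext i
    dsimp only
    omega
  · rintro ⟨l, j⟩ hq
    rw [Finset.mem_product, ← add_assoc, mem_subcubes_add, mem_subcubes_add] at hq
    have h2 := fun i => hq.2 i
    refine Prod.ext ?_ ?_ <;> funext i <;> have := h2 i <;> dsimp only at this ⊢ <;> omega
  · intro k _
    congr 1
    funext i
    dsimp only
    omega

theorem latticePt_succ_add (m : ℕ) (l j : Fin d → ℤ) :
    latticePt (m + 1) l + latticePt m j = latticePt m (fun i => 3 * l i + j i) := by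
  ext i
  simp only [PiLp.add_apply, latticePt_apply]
  push_cast
  ring

/-! ### The Cauchy-Schwarz inequality for integrals -/

section L2

variable {α F : Type*} [MeasurableSpace α] {μ : Measure α} [NormedAddCommGroup F]
  [InnerProductSpace ℝ F]

theorem inner_toLp {f g : α → F} (hf : MemLp f 2 μ) (hg : MemLp g 2 μ) :
    inner ℝ (hf.toLp f) (hg.toLp g) = ∫ x, inner ℝ (f x) (g x) ∂μ := by
  rw [L2.inner_def]
  refine integral_congr_ae ?_
  filter_upwards [hf.coeFn_toLp, hg.coeFn_toLp] with x h1 h2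
  rw [h1, h2]

theorem norm_toLp_sq {f : α → F} (hf : MemLp f 2 μ) :
    ‖hf.toLp f‖ ^ 2 = ∫ x, ‖f x‖ ^ 2 ∂μ := by
  rw [← real_inner_self_eq_norm_sq, inner_toLp hf hf]
  simp only [real_inner_self_eq_norm_sq]

theorem integrable_inner_of_memLp {f g : α → F} (hf : MemLp f 2 μ) (hg : MemLp g 2 μ) :
    Integrable (fun x => inner ℝ (f x) (g x)) μ := by
  refine (L2.integrable_inner (𝕜 := ℝ) (hf.toLp f) (hg.toLp g)).congr ?_
  filter_upwards [hf.coeFn_toLp, hg.coeFn_toLp] with x h1 h2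
  rw [h1, h2]

theorem integrable_norm_sq_of_memLp {f : α → F} (hf : MemLp f 2 μ) :
    Integrable (fun x => ‖f x‖ ^ 2) μ := by
  simpa only [real_inner_self_eq_norm_sq] using integrable_inner_of_memLp hf hf

theorem abs_integral_inner_le {f g : α → F} (hf : MemLp f 2 μ) (hg : MemLp g 2 μ) :
    |∫ x, inner ℝ (f x) (g x) ∂μ| ≤
      Real.sqrt (∫ x, ‖f x‖ ^ 2 ∂μ) * Real.sqrt (∫ x, ‖g x‖ ^ 2 ∂μ) := by
  rw [← inner_toLp hf hg, ← norm_toLp_sq hf, ← norm_toLp_sq hg, Real.sqrt_sq (norm_nonneg _),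
    Real.sqrt_sq (norm_nonneg _)]
  exact abs_real_inner_le_norm _ _

theorem norm_integral_sq_le [IsFiniteMeasure μ] [CompleteSpace F] {f : α → F} (hf : MemLp f 2 μ) :
    ‖∫ x, f x ∂μ‖ ^ 2 ≤ μ.real Set.univ * ∫ x, ‖f x‖ ^ 2 ∂μ := by
  have h := abs_integral_inner_le (μ := μ) hf.norm (memLp_const (1 : ℝ))
  simp only [norm_norm, norm_one, one_pow, integral_const, smul_eq_mul, mul_one] at h
  have e : ∀ x, inner ℝ ‖f x‖ (1 : ℝ) = ‖f x‖ := fun x => by simp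
  simp only [e] at h
  have h1 : ‖∫ x, f x ∂μ‖ ≤ Real.sqrt (∫ x, ‖f x‖ ^ 2 ∂μ) * Real.sqrt (μ.real Set.univ) :=
    (norm_integral_le_integral_norm _).trans ((le_abs_self _).trans h)
  calc ‖∫ x, f x ∂μ‖ ^ 2 ≤ (Real.sqrt (∫ x, ‖f x‖ ^ 2 ∂μ) * Real.sqrt (μ.real Set.univ)) ^ 2 := by
        gcongr
    _ = _ := by
        rw [mul_pow, Real.sq_sqrt (integral_nonneg fun _ => by positivity),
          Real.sq_sqrt measureReal_nonneg, mul_comm]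

end L2

/-! ### Test functions -/

namespace IsTest

variable {U V : Set (E d)} {φ ψ : E d → ℝ}

theorem mono (h : IsTest U φ) (hUV : U ⊆ V) : IsTest V φ := ⟨h.1, h.2.1, h.2.2.trans hUV⟩

theorem continuous (h : IsTest U φ) : Continuous φ := h.1.continuous

theorem differentiable (h : IsTest U φ) : Differentiable ℝ φ := h.1.differentiable (by simp)

theorem continuous_fderiv (h : IsTest U φ) : Continuous (fderiv ℝ φ) :=
  h.1.continuous_fderiv (by simp)

theorem eq_zero (h : IsTest U φ) {x : E d} (hx : x ∉ U) : φ x = 0 :=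
  image_eq_zero_of_notMem_tsupport fun hx' => hx (h.2.2 hx')

theorem fderiv_eq_zero (h : IsTest U φ) {x : E d} (hx : x ∉ U) : fderiv ℝ φ x = 0 := by
  by_contra hne
  exact hx (h.2.2 (support_fderiv_subset ℝ hne))

theorem memLp (h : IsTest U φ) (μ : Measure (E d)) [IsFiniteMeasureOnCompacts μ] : MemLp φ 2 μ :=
  h.continuous.memLp_of_hasCompactSupport h.2.1

theorem zero : IsTest U (fun _ => 0) :=
  ⟨contDiff_const, HasCompactSupport.zero, by
    have : tsupport (fun _ : E d => (0 : ℝ)) = ∅ := tsupport_eq_empty_iff.2 rfl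
    rw [this]; exact Set.empty_subset _⟩

theorem add (h : IsTest U φ) (h' : IsTest U ψ) : IsTest U (fun x => φ x + ψ x) :=
  ⟨h.1.add h'.1, h.2.1.add h'.2.1,
    (tsupport_add φ ψ).trans (Set.union_subset h.2.2 h'.2.2)⟩

theorem const_mul (c : ℝ) (h : IsTest U φ) : IsTest U (fun x => c * φ x) :=
  ⟨contDiff_const.mul h.1, h.2.1.mul_left, (tsupport_mul_subset_right).trans h.2.2⟩

theorem comp_sub (h : IsTest U φ) (y : E d) (hV : ∀ x ∈ U, x + y ∈ V) :
    IsTest V (fun x => φ (x - y)) := by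
  refine ⟨h.1.comp (contDiff_id.sub contDiff_const),
    h.2.1.comp_homeomorph (Homeomorph.subRight y), ?_⟩
  intro x hx
  have : x - y ∈ tsupport φ := by
    have := tsupport_comp_subset_preimage φ (Homeomorph.subRight y).continuous hx
    exact this
  simpa using hV _ (h.2.2 this)

end IsTest

theorem setIntegral_mul_test {U V : Set (E d)} (hVU : V ⊆ U) {f φ : E d → ℝ}
    (hφ : ∀ x ∉ V, φ x = 0) : ∫ x in U, f x * φ x = ∫ x in V, f x * φ x := by
  have e : ∀ W : Set (E d), V ⊆ W → ∫ x in W, f x * φ x = ∫ x, f x * φ x := fun W hW =>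
    setIntegral_eq_integral_of_forall_compl_eq_zero fun x hx => by
      rw [hφ x fun h => hx (hW h), mul_zero]
  rw [e U hVU, e V subset_rfl]

theorem IsH1.mono {U V : Set (E d)} (hVU : V ⊆ U) {u : E d → ℝ} {G : E d → E d}
    (h : IsH1 U u G) : IsH1 V u G := by
  refine ⟨h.1.mono_measure (Measure.restrict_mono_set _ hVU),
    h.2.1.mono_measure (Measure.restrict_mono_set _ hVU), fun φ hφ i => ?_⟩
  have := h.2.2 φ (hφ.mono hVU) i
  rwa [setIntegral_mul_test hVU fun x hx => by rw [hφ.fderiv_eq_zero hx]; rfl,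
    setIntegral_mul_test hVU fun x hx => hφ.eq_zero hx] at this

theorem IsH1.congr {U : Set (E d)} {u w : E d → ℝ} {G : E d → E d}
    (h : IsH1 U u G) (huw : u =ᵐ[volume.restrict U] w) : IsH1 U w G := by
  refine ⟨h.1.ae_eq huw, h.2.1, fun φ hφ i => ?_⟩
  rw [← h.2.2 φ hφ i]
  refine integral_congr_ae ?_
  filter_upwards [huw] with x hx
  rw [hx]

/-- Duality: test functions are dense in `L²(W)`, so the bound on pairings extends to all of
`L²(W)`, and pairing `f` with itself gives the claim. It turns weak estimates into norm estimates
without mollification. -/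
theorem integral_le_of_forall_isTest {W : Set (E d)} (hW : IsOpen W)
    [IsFiniteMeasure (volume.restrict W)] {f : E d → ℝ} (hf : MemLp f 2 (volume.restrict W))
    {M : ℝ} (hM : 0 ≤ M)
    (h : ∀ φ, IsTest W φ →
      |∫ x in W, f x * φ x| ≤ M * Real.sqrt (∫ x in W, φ x ^ 2)) :
    ∫ x in W, f x ^ 2 ≤ M ^ 2 := by
  let K : Submodule ℝ (Lp ℝ 2 (volume.restrict W)) :=
    { carrier := {g | ∃ φ, IsTest W φ ∧ g =ᵐ[volume.restrict W] φ}
      zero_mem' := ⟨_, IsTest.zero, Lp.coeFn_zero _ _ _⟩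
      add_mem' := by
        rintro a b ⟨φ, hφ, ha⟩ ⟨ψ, hψ, hb⟩
        exact ⟨_, hφ.add hψ, (Lp.coeFn_add a b).trans (ha.add hb)⟩
      smul_mem' := by
        rintro c a ⟨φ, hφ, ha⟩
        exact ⟨_, hφ.const_mul c, (Lp.coeFn_smul c a).trans (ha.const_smul c)⟩ }
  -- Density holds because a function orthogonal to all test functions vanishes almost everywhere,
  -- by the fundamental lemma of the calculus of variations.
  have hK : K.topologicalClosure = ⊤ := by
    rw [Submodule.topologicalClosure_eq_top_iff, Submodule.eq_bot_iff]
    intro g hg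
    have hgi : IntegrableOn g W := (Lp.memLp g).integrable (by norm_num)
    have h0 := hW.ae_eq_zero_of_integral_contDiff_smul_eq_zero hgi.locallyIntegrableOn (by
      intro φ h1 h2 h3
      have hφ : IsTest W φ := ⟨h1, h2, h3⟩
      have h4 := hg ((hφ.memLp (volume.restrict W)).toLp φ) ⟨φ, hφ, MemLp.coeFn_toLp _⟩
      rw [L2.inner_def] at h4
      rw [← setIntegral_eq_integral_of_forall_compl_eq_zero (s := W), ← h4]
      · refine integral_congr_ae ?_
        filter_upwards [(hφ.memLp (volume.restrict W)).coeFn_toLp] with x hx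
        rw [hx]
        simp [mul_comm]
      · intro x hx
        rw [hφ.eq_zero hx, zero_smul])
    rw [Lp.eq_zero_iff_ae_eq_zero]
    exact (ae_restrict_iff' hW.measurableSet).2 h0
  have key : ∀ g : Lp ℝ 2 (volume.restrict W), |inner ℝ (hf.toLp f) g| ≤ M * ‖g‖ := by
    intro g
    have hg : g ∈ closure (K : Set (Lp ℝ 2 (volume.restrict W))) := by
      rw [← Submodule.topologicalClosure_coe, hK]; trivial
    refine closure_minimal (t := {g | |inner ℝ (hf.toLp f) g| ≤ M * ‖g‖}) ?_
      (isClosed_le (by fun_prop) (by fun_prop)) hg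
    rintro g ⟨φ, hφ, hgφ⟩
    have e : g = (hφ.memLp (volume.restrict W)).toLp φ :=
      Lp.ext (hgφ.trans (MemLp.coeFn_toLp _).symm)
    have h1 := h φ hφ
    rw [Set.mem_ofPred_eq, e, inner_toLp, ← Real.sqrt_sq (norm_nonneg (MemLp.toLp φ _)),
      norm_toLp_sq]
    simpa [mul_comm] using h1
  have h1 := key (hf.toLp f)
  rw [real_inner_self_eq_norm_sq, abs_of_nonneg (by positivity), sq] at h1
  have h2 : ‖hf.toLp f‖ ≤ M := by
    rcases (norm_nonneg (hf.toLp f)).eq_or_lt with h0 | h0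
    · rw [← h0]; exact hM
    · exact le_of_mul_le_mul_right h1 h0
  have h3 := norm_toLp_sq hf
  simp only [Real.norm_eq_abs, sq_abs] at h3
  rw [← h3]
  gcongr

/-! ### The Poincaré inequality on cubes -/

theorem IsH1.integral_fderiv {U : Set (E d)} {u : E d → ℝ} {G : E d → E d} (h : IsH1 U u G)
    {φ : E d → ℝ} (hφ : IsTest U φ) (y : E d) :
    ∫ x in U, u x * fderiv ℝ φ x y = - ∫ x in U, inner ℝ (G x) y * φ x := by
  have hy : y = ∑ i, y i • basisVec i := by
    ext j
    simp [basisVec, Finset.sum_apply, Pi.single_apply]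
  have e1 : ∀ x, u x * fderiv ℝ φ x y = ∑ i, y i * (u x * fderiv ℝ φ x (basisVec i)) := by
    intro x
    conv_lhs => rw [hy]
    rw [map_sum, Finset.mul_sum]
    refine Finset.sum_congr rfl fun i _ => ?_
    rw [map_smul, smul_eq_mul]; ring
  have e2 : ∀ x, inner ℝ (G x) y * φ x = ∑ i, y i * (G x i * φ x) := by
    intro x
    rw [PiLp.inner_apply, Finset.sum_mul]
    refine Finset.sum_congr rfl fun i _ => ?_
    simp; ring
  have hd : ∀ i, MemLp (fun x => fderiv ℝ φ x (basisVec i)) 2 (volume.restrict U) := fun i =>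
    (hφ.continuous_fderiv.clm_apply continuous_const).memLp_of_hasCompactSupport
      (hφ.2.1.fderiv_apply ℝ (basisVec i))
  have hG : ∀ i, MemLp (fun x => G x i) 2 (volume.restrict U) := fun i =>
    (EuclideanSpace.proj (𝕜 := ℝ) i).comp_memLp' h.2.1
  simp only [e1, e2]
  rw [integral_finsetSum, integral_finsetSum, ← Finset.sum_neg_distrib]
  · refine Finset.sum_congr rfl fun i _ => ?_
    rw [integral_const_mul, integral_const_mul, h.2.2 φ hφ i, mul_neg]
  · intro i _
    exact ((hG i).integrable_mul (hφ.memLp _)).const_mul _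
  · intro i _
    exact (h.1.integrable_mul (hd i)).const_mul _

/-- Along `t ↦ ∫ u(x) φ(x - t y) dx` the derivative falls on `φ`; the weak gradient turns it into `∫
(G · y) φ(x - t y)`, which Cauchy–Schwarz bounds uniformly in `t`. The segment condition keeps every
translate of `φ` supported in `U`. -/
theorem IsH1.abs_integral_translate_le {U W : Set (E d)} [IsFiniteMeasure (volume.restrict U)]
    {u : E d → ℝ} {G : E d → E d} (h : IsH1 U u G) (y : E d)
    (hW : ∀ x ∈ W, ∀ t ∈ Set.Icc (0 : ℝ) 1, x + t • y ∈ U) {φ : E d → ℝ} (hφ : IsTest W φ) :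
    |(∫ x in U, u x * φ (x - y)) - ∫ x in U, u x * φ x| ≤
      ‖y‖ * Real.sqrt (∫ x in U, ‖G x‖ ^ 2) * Real.sqrt (∫ x, φ x ^ 2) := by
  obtain ⟨B, hB⟩ := hφ.continuous_fderiv.bounded_above_of_compact_support (hφ.2.1.fderiv ℝ)
  have hφt : ∀ t ∈ Set.Icc (0 : ℝ) 1, IsTest U (fun x => φ (x - t • y)) := fun t ht =>
    hφ.comp_sub _ fun x hx => hW x hx t ht
  have hu : Integrable u (volume.restrict U) := h.1.integrable (by norm_num)
  have hmeas : ∀ t : ℝ, Continuous fun x => φ (x - t • y) := fun t =>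
    hφ.continuous.comp (by fun_prop)
  have hderiv : ∀ t : ℝ, HasDerivAt (fun t : ℝ => ∫ x in U, u x * φ (x - t • y))
      (∫ x in U, u x * (-(fderiv ℝ φ (x - t • y) y))) t := by
    intro t
    refine (hasDerivAt_integral_of_dominated_loc_of_deriv_le (bound := fun x => ‖u x‖ * (B * ‖y‖))
      (F' := fun t x => u x * (-(fderiv ℝ φ (x - t • y) y))) Filter.univ_mem
      (Eventually.of_forall fun s => hu.1.mul (hmeas s).aestronglyMeasurable) ?_
      (hu.1.mul ?_) ?_ (hu.norm.mul_const _) ?_).2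
    · obtain ⟨A, hA⟩ := hφ.continuous.bounded_above_of_compact_support hφ.2.1
      exact hu.mul_bdd (hmeas t).aestronglyMeasurable (ae_of_all _ fun x => hA _)
    · exact (((hφ.continuous_fderiv.comp (by fun_prop : Continuous fun x => x - t • y)).clm_apply
        continuous_const).neg).aestronglyMeasurable
    · refine ae_of_all _ fun x s _ => ?_
      rw [norm_mul, norm_neg]
      gcongr
      exact (ContinuousLinearMap.le_opNorm _ _).trans (by gcongr; exact hB _)
    · refine ae_of_all _ fun x s _ => ?_
      have h1 : HasDerivAt (fun s : ℝ => x - s • y) (-y) s := by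
        simpa using ((hasDerivAt_id s).smul_const y).const_sub x
      have h2 := (hφ.differentiable (x - s • y)).hasFDerivAt.comp_hasDerivAt s h1
      simpa using h2.const_mul (u x)
  have hbound : ∀ t ∈ Set.Icc (0 : ℝ) 1, ‖∫ x in U, u x * (-(fderiv ℝ φ (x - t • y) y))‖ ≤
      ‖y‖ * Real.sqrt (∫ x in U, ‖G x‖ ^ 2) * Real.sqrt (∫ x, φ x ^ 2) := by
    intro t ht
    have e : ∀ x, fderiv ℝ (fun x => φ (x - t • y)) x = fderiv ℝ φ (x - t • y) := fun x =>
      fderiv_comp_sub (f := φ) (t • y)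
    have h1 := h.integral_fderiv (hφt t ht) y
    simp only [e] at h1
    simp only [mul_neg, integral_neg, norm_neg]
    rw [h1, norm_neg, Real.norm_eq_abs]
    have e3 : ∀ x, inner ℝ (G x) y * φ (x - t • y) = inner ℝ (G x) (φ (x - t • y) • y) := fun x => by
      rw [inner_smul_right, mul_comm]
    simp only [e3]
    have hm : MemLp (fun x => φ (x - t • y)) 2 volume := (hφt t ht).memLp _
    refine (abs_integral_inner_le h.2.1 ?_).trans ?_
    · exact (ContinuousLinearMap.smulRight (1 : ℝ →L[ℝ] ℝ) y).comp_memLp'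
        ((hφt t ht).memLp (volume.restrict U))
    · have e4 : ∀ x, ‖φ (x - t • y) • y‖ ^ 2 = φ (x - t • y) ^ 2 * ‖y‖ ^ 2 := fun x => by
        rw [norm_smul, mul_pow, Real.norm_eq_abs, sq_abs]
      simp only [e4]
      rw [integral_mul_const, Real.sqrt_mul' _ (by positivity), Real.sqrt_sq (norm_nonneg _)]
      have h5 : ∫ x in U, φ (x - t • y) ^ 2 ≤ ∫ x, φ x ^ 2 := by
        rw [← integral_sub_right_eq_self (fun x => φ x ^ 2) (t • y)]
        refine setIntegral_le_integral ?_ (ae_of_all _ fun x => by positivity)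
        simpa using integrable_norm_sq_of_memLp hm
      calc _ ≤ Real.sqrt (∫ x in U, ‖G x‖ ^ 2) * (Real.sqrt (∫ x, φ x ^ 2) * ‖y‖) := by gcongr
        _ = _ := by ring
  have := (convex_Icc (0 : ℝ) 1).norm_image_sub_le_of_norm_hasDerivWithin_le
    (fun t ht => (hderiv t).hasDerivWithinAt) hbound (Set.left_mem_Icc.2 zero_le_one)
    (Set.right_mem_Icc.2 zero_le_one)
  simpa using this

/-- The previous weak bound, made strong by duality. Convexity of `U` puts the whole segment from
`x` to `x + y` in `U` once its endpoints are. -/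
theorem IsH1.integral_translate_sub_sq_le {U : Set (E d)} (hU : IsOpen U) (hc : Convex ℝ U)
    [IsFiniteMeasure (volume.restrict U)]
    {u : E d → ℝ} {G : E d → E d} (h : IsH1 U u G) (y : E d) :
    IntegrableOn (fun x => (u (x + y) - u x) ^ 2) (U ∩ {x | x + y ∈ U}) ∧
    ∫ x in U ∩ {x | x + y ∈ U}, (u (x + y) - u x) ^ 2 ≤ ‖y‖ ^ 2 * ∫ x in U, ‖G x‖ ^ 2 := by
  set W := U ∩ {x | x + y ∈ U} with hWdef
  have hWo : IsOpen W := hU.inter (hU.preimage (continuous_id.add continuous_const))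
  have : IsFiniteMeasure (volume.restrict W) :=
    isFiniteMeasure_of_le _ (Measure.restrict_mono_set volume Set.inter_subset_left)
  have hind : MemLp (U.indicator u) 2 volume := (memLp_indicator_iff_restrict hU.measurableSet).2 h.1
  have hindy : MemLp (fun x => U.indicator u (x + y)) 2 volume :=
    hind.comp_measurePreserving (measurePreserving_add_right volume y)
  have hW1 : ∀ x ∈ W, U.indicator u (x + y) = u (x + y) := fun x hx =>
    Set.indicator_of_mem (s := U) hx.2 _
  have hW2 : ∀ x ∈ W, U.indicator u x = u x := fun x hx => Set.indicator_of_mem hx.1 _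
  have m1 : MemLp (fun x => u (x + y)) 2 (volume.restrict W) :=
    (hindy.restrict W).ae_eq ((ae_restrict_iff' hWo.measurableSet).2 (ae_of_all _ hW1))
  have m2 : MemLp u 2 (volume.restrict W) :=
    h.1.mono_measure (Measure.restrict_mono_set volume Set.inter_subset_left)
  have m3 : MemLp (fun x => u (x + y) - u x) 2 (volume.restrict W) := m1.sub m2
  refine ⟨by simpa [IntegrableOn] using integrable_norm_sq_of_memLp m3, ?_⟩
  have hG : 0 ≤ ∫ x in U, ‖G x‖ ^ 2 := integral_nonneg fun _ => by positivity
  rw [← Real.sq_sqrt hG, ← mul_pow]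
  refine integral_le_of_forall_isTest hWo m3 (by positivity) fun φ hφ => ?_
  have hseg : ∀ x ∈ W, ∀ t ∈ Set.Icc (0 : ℝ) 1, x + t • y ∈ U := by
    intro x hx t ht
    have := hc hx.1 hx.2 (sub_nonneg.2 ht.2) ht.1 (by ring)
    convert this using 1
    module
  have h1 := h.abs_integral_translate_le y hseg hφ
  have e1 : ∫ x in W, φ x ^ 2 = ∫ x, φ x ^ 2 :=
    setIntegral_eq_integral_of_forall_compl_eq_zero fun x hx => by rw [hφ.eq_zero hx]; ring
  -- Extending `u` by zero allows the translation to be performed on all of space.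
  have e2 : ∫ x in U, u x * φ (x - y) = ∫ x in W, u (x + y) * φ x := by
    calc ∫ x in U, u x * φ (x - y) = ∫ x, U.indicator u x * φ (x - y) := by
          rw [← integral_indicator hU.measurableSet]
          refine integral_congr_ae (ae_of_all _ fun x => ?_)
          by_cases hx : x ∈ U <;> simp [hx]
      _ = ∫ x, U.indicator u (x + y) * φ x := by
          rw [← integral_add_right_eq_self _ y]
          simp
      _ = ∫ x in W, U.indicator u (x + y) * φ x :=
          (setIntegral_eq_integral_of_forall_compl_eq_zero fun x hx => by
            rw [hφ.eq_zero hx, mul_zero]).symm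
      _ = ∫ x in W, u (x + y) * φ x :=
          setIntegral_congr_fun hWo.measurableSet fun x hx => by
            simp only [hW1 x hx]
  have e3 : ∫ x in U, u x * φ x = ∫ x in W, u x * φ x :=
    setIntegral_mul_test Set.inter_subset_left fun x hx => hφ.eq_zero hx
  have i1 : Integrable (fun x => u (x + y) * φ x) (volume.restrict W) :=
    m1.integrable_mul (hφ.memLp _)
  have i2 : Integrable (fun x => u x * φ x) (volume.restrict W) := m2.integrable_mul (hφ.memLp _)
  rw [e2, e3, ← integral_sub i1 i2] at h1
  rw [e1]
  simpa only [sub_mul] using h1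

theorem norm_sq_le_of_forall_abs_le {h : E d} {L : ℝ} (hh : ∀ i, |h i| ≤ L) :
    ‖h‖ ^ 2 ≤ d * L ^ 2 := by
  rw [EuclideanSpace.norm_sq_eq]
  calc ∑ i, ‖h i‖ ^ 2 ≤ ∑ _i : Fin d, L ^ 2 := by
        gcongr with i _
        exact hh i
    _ = d * L ^ 2 := by simp

/-- Substitute `x + y` for `y` and exchange the integrals: for each shift `y` the inner integral is
the translation estimate. Nonnegative integrals let Tonelli apply with measurability alone. -/
theorem IsH1.lintegral_lintegral_sub_sq_le {z : E d} {n : ℕ} {u : E d → ℝ} {G : E d → E d}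
    (h : IsH1 (cube z n) u G) (hu : Measurable u) :
    ∫⁻ x in cube z n, ∫⁻ y in cube z n, ENNReal.ofReal ((u y - u x) ^ 2) ≤
      ENNReal.ofReal ((3 ^ (n + 1)) ^ d * (d * (3 ^ n) ^ 2 * ∫ x in cube z n, ‖G x‖ ^ 2)) := by
  set Q := cube z n with hQ
  have hQm : MeasurableSet Q := measurableSet_cube z n
  set g : E d → E d → ℝ≥0∞ := fun x y =>
    Q.indicator 1 x * (Q.indicator 1 y * ENNReal.ofReal ((u y - u x) ^ 2)) with hg
  have hind : Measurable (Q.indicator (1 : E d → ℝ≥0∞)) := measurable_one.indicator hQm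
  have h1 : ∫⁻ x in Q, ∫⁻ y in Q, ENNReal.ofReal ((u y - u x) ^ 2) = ∫⁻ x, ∫⁻ y, g x y := by
    rw [← lintegral_indicator hQm]
    refine lintegral_congr fun x => ?_
    simp only [hg]
    by_cases hx : x ∈ Q
    · simp only [Set.indicator_of_mem hx, Pi.one_apply, one_mul]
      rw [← lintegral_indicator hQm]
      refine lintegral_congr fun y => ?_
      by_cases hy : y ∈ Q <;> simp [hy]
    · simp [hx]
  have h2 : ∫⁻ x, ∫⁻ y, g x y = ∫⁻ y, ∫⁻ x, g x (x + y) := by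
    rw [lintegral_congr fun x => (lintegral_add_left_eq_self (g x) x).symm,
      lintegral_lintegral_swap]
    · refine Measurable.aemeasurable ?_
      simp only [hg, Function.uncurry_def]
      exact (hind.comp measurable_fst).mul ((hind.comp (measurable_fst.add measurable_snd)).mul
        (((hu.comp (measurable_fst.add measurable_snd)).sub
          (hu.comp measurable_fst)).pow_const 2).ennreal_ofReal)
  have h3 : ∀ y, ∫⁻ x, g x (x + y) ≤ (cube (0 : E d) (n + 1)).indicator
      (fun _ => ENNReal.ofReal (d * (3 ^ n) ^ 2 * ∫ x in Q, ‖G x‖ ^ 2)) y := by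
    intro y
    have hWm : MeasurableSet (Q ∩ {x | x + y ∈ Q}) :=
      hQm.inter (hQm.preimage (measurable_add_const y))
    have e1 : ∫⁻ x, g x (x + y) =
        ∫⁻ x in Q ∩ {x | x + y ∈ Q}, ENNReal.ofReal ((u (x + y) - u x) ^ 2) := by
      rw [← lintegral_indicator hWm]
      refine lintegral_congr fun x => ?_
      simp only [hg]
      by_cases hx : x ∈ Q <;> by_cases hxy : x + y ∈ Q <;> simp [hx, hxy]
    rw [e1]
    by_cases hne : (Q ∩ {x | x + y ∈ Q}).Nonempty
    · obtain ⟨x, hx, hxy⟩ := hne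
      have hy : ∀ i, |y i| < 3 ^ n := fun i => by
        have := abs_sub_lt_of_mem_cube hxy hx i
        simpa using this
      -- Differences of points of the cube have coordinates below `3^n`, less than the half-width
      -- `3^(n+1)/2` of the next triadic cube; this costs a factor `3^d` in volume.
      have hmem : y ∈ cube (0 : E d) (n + 1) := fun i => by
        have h3 : (0 : ℝ) < 3 ^ n := by positivity
        have := hy i
        rw [PiLp.zero_apply, sub_zero, pow_succ]
        linarith
      rw [Set.indicator_of_mem hmem]
      obtain ⟨hi, hle⟩ := h.integral_translate_sub_sq_le (isOpen_cube z n) (convex_cube z n) y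
      rw [← ofReal_integral_eq_lintegral_ofReal hi (ae_of_all _ fun x => by positivity)]
      refine ENNReal.ofReal_le_ofReal (hle.trans ?_)
      exact mul_le_mul_of_nonneg_right (norm_sq_le_of_forall_abs_le fun i => (hy i).le)
        (integral_nonneg fun _ => by positivity)
    · rw [Set.not_nonempty_iff_eq_empty] at hne
      rw [hne]
      simp
  calc _ = ∫⁻ y, ∫⁻ x, g x (x + y) := by rw [h1, h2]
    _ ≤ ∫⁻ y, (cube (0 : E d) (n + 1)).indicator
          (fun _ => ENNReal.ofReal (d * (3 ^ n) ^ 2 * ∫ x in Q, ‖G x‖ ^ 2)) y := lintegral_mono h3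
    _ = _ := by
      rw [lintegral_indicator (measurableSet_cube _ _), setLIntegral_const, volume_cube,
        mul_comm, ← ENNReal.ofReal_mul (by positivity)]

/-- By Jensen, `(u(x) - ⨍ u)²` is at most the mean over `y` of `(u(y) - u(x))²`; integrate in `x`.
-/
theorem integral_sub_setAverage_sq_le {z : E d} {n : ℕ} {u : E d → ℝ} {B : ℝ} (hB : 0 ≤ B)
    (hu : MemLp u 2 (volume.restrict (cube z n)))
    (h : ∫⁻ x in cube z n, ∫⁻ y in cube z n, ENNReal.ofReal ((u y - u x) ^ 2) ≤
      ENNReal.ofReal ((3 ^ n) ^ d * B)) :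
    ∫ x in cube z n, (u x - ⨍ y in cube z n, u y) ^ 2 ≤ B := by
  set Q := cube z n
  set V : ℝ := (3 ^ n) ^ d with hV
  have hVpos : 0 < V := by positivity
  have hreal : volume.real Q = V := real_cube z n
  have hint : Integrable u (volume.restrict Q) := hu.integrable (by norm_num)
  have hpt : ∀ x, ENNReal.ofReal ((u x - ⨍ y in Q, u y) ^ 2) ≤
      ENNReal.ofReal V⁻¹ * ∫⁻ y in Q, ENNReal.ofReal ((u y - u x) ^ 2) := by
    intro x
    have hm : MemLp (fun y => u y - u x) 2 (volume.restrict Q) := hu.sub (memLp_const _)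
    have hi : Integrable (fun y => (u y - u x) ^ 2) (volume.restrict Q) := by
      simpa using integrable_norm_sq_of_memLp hm
    have h1 := norm_integral_sq_le hm
    rw [← ofReal_integral_eq_lintegral_ofReal hi (ae_of_all _ fun x => by positivity),
      ← ENNReal.ofReal_mul (by positivity)]
    refine ENNReal.ofReal_le_ofReal ?_
    rw [integral_sub hint (integrable_const _), integral_const] at h1
    simp only [measureReal_restrict_apply MeasurableSet.univ, Set.univ_inter, hreal,
      Real.norm_eq_abs, sq_abs, smul_eq_mul] at h1
    rw [setAverage_eq, hreal, smul_eq_mul]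
    have e : (u x - V⁻¹ * ∫ y in Q, u y) ^ 2 = V⁻¹ * (V⁻¹ * ((∫ y in Q, u y) - V * u x) ^ 2) := by
      field_simp; ring
    rw [e]
    gcongr
    rwa [inv_mul_le_iff₀ hVpos]
  have hm : MemLp (fun x => u x - ⨍ y in Q, u y) 2 (volume.restrict Q) := hu.sub (memLp_const _)
  have hi : Integrable (fun x => (u x - ⨍ y in Q, u y) ^ 2) (volume.restrict Q) := by
    simpa using integrable_norm_sq_of_memLp hm
  rw [← ENNReal.ofReal_le_ofReal_iff hB,
    ofReal_integral_eq_lintegral_ofReal hi (ae_of_all _ fun x => by positivity)]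
  calc _ ≤ ∫⁻ x in Q, ENNReal.ofReal V⁻¹ * ∫⁻ y in Q, ENNReal.ofReal ((u y - u x) ^ 2) :=
        lintegral_mono hpt
    _ = ENNReal.ofReal V⁻¹ * ∫⁻ x in Q, ∫⁻ y in Q, ENNReal.ofReal ((u y - u x) ^ 2) :=
        lintegral_const_mul' _ _ ENNReal.ofReal_ne_top
    _ ≤ ENNReal.ofReal V⁻¹ * ENNReal.ofReal (V * B) := by gcongr
    _ = ENNReal.ofReal B := by
        rw [← ENNReal.ofReal_mul (by positivity), inv_mul_cancel_left₀ hVpos.ne']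

/-- The square of the constant in the Poincaré inequality on unit cubes. -/
def poincareConst (d : ℕ) : ℝ := 3 ^ d * d

theorem IsH1.poincare {z : E d} {n : ℕ} {u : E d → ℝ} {G : E d → E d}
    (h : IsH1 (cube z n) u G) :
    ∫ x in cube z n, (u x - ⨍ y in cube z n, u y) ^ 2 ≤
      poincareConst d * (3 ^ n) ^ 2 * ∫ x in cube z n, ‖G x‖ ^ 2 := by
  have hG : 0 ≤ ∫ x in cube z n, ‖G x‖ ^ 2 := integral_nonneg fun _ => by positivity
  -- The double integral needs joint measurability, hence a measurable representative of `u`.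
  have hae := h.1.1.ae_eq_mk
  have h' := h.congr hae
  have hav : ⨍ y in cube z n, u y = ⨍ y in cube z n, h.1.1.mk u y := average_congr hae
  have e : ∫ x in cube z n, (u x - ⨍ y in cube z n, u y) ^ 2 =
      ∫ x in cube z n, (h.1.1.mk u x - ⨍ y in cube z n, h.1.1.mk u y) ^ 2 := by
    rw [hav]
    refine integral_congr_ae ?_
    filter_upwards [hae] with x hx
    rw [hx]
  rw [e]
  refine integral_sub_setAverage_sq_le (by unfold poincareConst; positivity) h'.1
    ((h'.lintegral_lintegral_sub_sq_le h.1.1.stronglyMeasurable_mk.measurable).trans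
      (ENNReal.ofReal_le_ofReal (le_of_eq ?_)))
  rw [poincareConst, pow_succ, mul_pow]
  ring

theorem memLp_of_forall_apply {μ : Measure (E d)} {Ψ : E d → E d}
    (h : ∀ i, MemLp (fun x => Ψ x i) 2 μ) : MemLp Ψ 2 μ := by
  have e : Ψ = fun x => ∑ i, (Ψ x i) • basisVec i := by
    funext x
    ext j
    simp [basisVec, Finset.sum_apply, Pi.single_apply]
  rw [e]
  exact memLp_finsetSum _ fun i _ =>
    (ContinuousLinearMap.smulRight (1 : ℝ →L[ℝ] ℝ) (basisVec i)).comp_memLp' (h i)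

theorem setAverage_apply {U : Set (E d)} {Ψ : E d → E d} (h : IntegrableOn Ψ U) (i : Fin d) :
    (⨍ x in U, Ψ x) i = ⨍ x in U, Ψ x i := by
  rw [setAverage_eq, setAverage_eq, PiLp.smul_apply]
  congr 1
  exact ((EuclideanSpace.proj (𝕜 := ℝ) i).integral_comp_comm h).symm

/-- The Poincaré inequality for vector fields. -/
theorem integral_norm_sub_setAverage_sq_le {z : E d} {n : ℕ} {Ψ : E d → E d}
    {D : Fin d → E d → E d} (h : ∀ i, IsH1 (cube z n) (fun x => Ψ x i) (D i)) :
    ∫ x in cube z n, ‖Ψ x - ⨍ y in cube z n, Ψ y‖ ^ 2 ≤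
      poincareConst d * (3 ^ n) ^ 2 * ∫ x in cube z n, ∑ i, ‖D i x‖ ^ 2 := by
  have hΨ : MemLp Ψ 2 (volume.restrict (cube z n)) := memLp_of_forall_apply fun i => (h i).1
  have hint : IntegrableOn Ψ (cube z n) := hΨ.integrable (by norm_num)
  rw [integral_finsetSum _ fun i _ => integrable_norm_sq_of_memLp (h i).2.1, Finset.mul_sum]
  simp only [EuclideanSpace.norm_sq_eq, PiLp.sub_apply, setAverage_apply hint, Real.norm_eq_abs,
    sq_abs]
  rw [integral_finsetSum]
  · refine Finset.sum_le_sum fun i _ => ?_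
    simpa [EuclideanSpace.norm_sq_eq] using (h i).poincare
  · intro i _
    have hm : MemLp (fun x => Ψ x i - ⨍ y in cube z n, Ψ y i) 2 (volume.restrict (cube z n)) :=
      (h i).1.sub (memLp_const _)
    simpa using integrable_norm_sq_of_memLp hm

/-! ### The multiscale Poincaré inequality -/

theorem abs_sum_le_sqrt_mul_sqrt {ι : Type*} (s : Finset ι) {f a b : ι → ℝ}
    (ha : ∀ i ∈ s, 0 ≤ a i) (hb : ∀ i ∈ s, 0 ≤ b i)
    (h : ∀ i ∈ s, |f i| ≤ Real.sqrt (a i) * Real.sqrt (b i)) :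
    |∑ i ∈ s, f i| ≤ Real.sqrt (∑ i ∈ s, a i) * Real.sqrt (∑ i ∈ s, b i) := by
  calc |∑ i ∈ s, f i| ≤ ∑ i ∈ s, |f i| := Finset.abs_sum_le_sum_abs _ _
    _ ≤ ∑ i ∈ s, Real.sqrt (a i) * Real.sqrt (b i) := Finset.sum_le_sum h
    _ ≤ Real.sqrt (∑ i ∈ s, Real.sqrt (a i) ^ 2) * Real.sqrt (∑ i ∈ s, Real.sqrt (b i) ^ 2) :=
        Real.sum_mul_le_sqrt_mul_sqrt _ _ _
    _ = _ := by
        rw [Finset.sum_congr rfl fun i hi => Real.sq_sqrt (ha i hi),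
          Finset.sum_congr rfl fun i hi => Real.sq_sqrt (hb i hi)]

theorem restrict_univ_cube (z : E d) (n : ℕ) :
    (volume.restrict (cube z n)).real Set.univ = (3 ^ n) ^ d := by
  rw [measureReal_restrict_apply MeasurableSet.univ, Set.univ_inter, real_cube]

theorem setAverage_cube {F : Type*} [NormedAddCommGroup F] [NormedSpace ℝ F] (z : E d) (n : ℕ)
    (f : E d → F) : ⨍ x in cube z n, f x = ((3 ^ n) ^ d : ℝ)⁻¹ • ∫ x in cube z n, f x := by
  rw [setAverage_eq, real_cube]

theorem norm_setAverage_sq_le {z : E d} {n : ℕ} {F : E d → E d}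
    (hF : MemLp F 2 (volume.restrict (cube z n))) :
    ‖⨍ x in cube z n, F x‖ ^ 2 ≤ ⨍ x in cube z n, ‖F x‖ ^ 2 := by
  have h := norm_integral_sq_le hF
  rw [restrict_univ_cube] at h
  have hV : (0 : ℝ) < (3 ^ n) ^ d := by positivity
  rw [setAverage_cube, setAverage_cube, norm_smul, Real.norm_of_nonneg (by positivity), mul_pow,
    sq (((3 ^ n) ^ d : ℝ)⁻¹), mul_assoc, smul_eq_mul]
  gcongr
  rwa [inv_mul_le_iff₀ hV]

/-- The sum over the subcubes of size `3^m` of the inner products of the means of `F` and `Ψ`. -/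
def pairing (F Ψ : E d → E d) (n m : ℕ) : ℝ :=
  ∑ k ∈ subcubes d n m, inner ℝ (∫ x in cube (latticePt m k) m, F x)
    (⨍ x in cube (latticePt m k) m, Ψ x)

/-- The normalized norm of the piecewise constant means of `F` at scale `3^m`. -/
def meanNorm (F : E d → E d) (n m : ℕ) : ℝ :=
  Real.sqrt (((3 : ℝ) ^ ((n - m) * d))⁻¹ *
    ∑ k ∈ subcubes d n m, ‖⨍ x in cube (latticePt m k) m, F x‖ ^ 2)

theorem latticePt_subcube_subset {n m : ℕ} (h : m ≤ n) {k : Fin d → ℤ}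
    (hk : k ∈ subcubes d n m) : cube (latticePt m k) m ⊆ cube (0 : E d) n := by
  simpa using subcube_subset h (0 : E d) hk

theorem integral_cube_zero_eq_sum {F : Type*} [NormedAddCommGroup F] [NormedSpace ℝ F] {n m : ℕ}
    (h : m ≤ n) {f : E d → F} (hf : IntegrableOn f (cube 0 n)) :
    ∫ x in cube (0 : E d) n, f x = ∑ k ∈ subcubes d n m, ∫ x in cube (latticePt m k) m, f x := by
  simpa using integral_cube_eq_sum h (0 : E d) hf

theorem cube_pow_eq {n m : ℕ} (h : m ≤ n) :
    ((3 : ℝ) ^ n) ^ d = (3 ^ m) ^ d * 3 ^ ((n - m) * d) := by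
  obtain ⟨j, rfl⟩ := Nat.exists_eq_add_of_le h
  rw [Nat.add_sub_cancel_left, pow_mul, ← mul_pow, pow_add]

theorem sqrt_sum_mean_sq {n m : ℕ} (h : m ≤ n) (F : E d → E d) :
    Real.sqrt (∑ k ∈ subcubes d n m, (3 ^ m) ^ d * ‖⨍ x in cube (latticePt m k) m, F x‖ ^ 2) =
      Real.sqrt ((3 ^ n) ^ d) * meanNorm F n m := by
  rw [meanNorm, ← Real.sqrt_mul (by positivity), cube_pow_eq h, ← Finset.mul_sum]
  congr 1
  field_simp

/-- The local estimate for every change of scale. The constant `c` is free: the mean of `Ψ` over the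
parent cube in the telescoping, zero at the top scale. -/
theorem abs_inner_integral_sub_le {z : E d} {m : ℕ} (F : E d → E d) {Ψ : E d → E d}
    (hΨ : MemLp Ψ 2 (volume.restrict (cube z m))) (c : E d) :
    |inner ℝ (∫ x in cube z m, F x) ((⨍ x in cube z m, Ψ x) - c)| ≤
      Real.sqrt ((3 ^ m) ^ d * ‖⨍ x in cube z m, F x‖ ^ 2) *
        Real.sqrt (∫ x in cube z m, ‖Ψ x - c‖ ^ 2) := by
  have hV : (0 : ℝ) < (3 ^ m) ^ d := by positivity
  have hi : IntegrableOn Ψ (cube z m) := hΨ.integrable (by norm_num)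
  have e4 : (⨍ x in cube z m, Ψ x) - c = ⨍ x in cube z m, (Ψ x - c) := by
    rw [setAverage_cube, setAverage_cube, integral_sub hi (integrable_const _), integral_const,
      restrict_univ_cube, smul_sub, inv_smul_smul₀ hV.ne']
  have e5 : ∫ x in cube z m, F x = ((3 : ℝ) ^ m) ^ d • ⨍ x in cube z m, F x := by
    rw [setAverage_cube, smul_inv_smul₀ hV.ne']
  have h6 : ((3 : ℝ) ^ m) ^ d * ‖⨍ x in cube z m, (Ψ x - c)‖ ^ 2 ≤
      ∫ x in cube z m, ‖Ψ x - c‖ ^ 2 := by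
    have hs : MemLp (fun x => Ψ x - c) 2 (volume.restrict (cube z m)) := hΨ.sub (memLp_const _)
    have := norm_setAverage_sq_le hs
    rw [setAverage_cube (f := fun x => ‖Ψ x - c‖ ^ 2), smul_eq_mul, ← div_eq_inv_mul,
      le_div_iff₀' hV] at this
    exact this
  refine (abs_real_inner_le_norm _ _).trans ?_
  rw [e4, e5, norm_smul, Real.norm_of_nonneg hV.le]
  calc _ = Real.sqrt ((3 ^ m) ^ d * ‖⨍ x in cube z m, F x‖ ^ 2) *
        Real.sqrt ((3 ^ m) ^ d * ‖⨍ x in cube z m, (Ψ x - c)‖ ^ 2) := by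
        rw [Real.sqrt_mul hV.le, Real.sqrt_mul hV.le, Real.sqrt_sq (norm_nonneg _),
          Real.sqrt_sq (norm_nonneg _)]
        linear_combination (-(‖⨍ x in cube z m, F x‖ * ‖⨍ x in cube z m, (Ψ x - c)‖)) *
          Real.mul_self_sqrt hV.le
    _ ≤ _ := mul_le_mul_of_nonneg_left (Real.sqrt_le_sqrt h6) (Real.sqrt_nonneg _)

section

variable {n : ℕ} {F Ψ : E d → E d} {D : Fin d → E d → E d}

/-- On each unit cube the difference is `∫ F · (Ψ - ⨍ Ψ)`. The Poincaré inequality has no scale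
factor there, and only the full `L²` norm of `F` enters. -/
theorem abs_integral_sub_pairing_le (hF : MemLp F 2 (volume.restrict (cube 0 n)))
    (hΨ : ∀ i, IsH1 (cube 0 n) (fun x => Ψ x i) (D i)) :
    |(∫ x in cube 0 n, inner ℝ (F x) (Ψ x)) - pairing F Ψ n 0| ≤
      Real.sqrt (∫ x in cube 0 n, ‖F x‖ ^ 2) *
        Real.sqrt (poincareConst d * ∫ x in cube 0 n, ∑ i, ‖D i x‖ ^ 2) := by
  have hΨ2 : MemLp Ψ 2 (volume.restrict (cube 0 n)) := memLp_of_forall_apply fun i => (hΨ i).1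
  have hD : Integrable (fun x => ∑ i, ‖D i x‖ ^ 2) (volume.restrict (cube 0 n)) :=
    integrable_finsetSum _ fun i _ => integrable_norm_sq_of_memLp (hΨ i).2.1
  have hsub := fun k (hk : k ∈ subcubes d n 0) =>
    Measure.restrict_mono_set volume (latticePt_subcube_subset (Nat.zero_le n) hk)
  have hc : 0 ≤ poincareConst d := by unfold poincareConst; positivity
  rw [integral_cube_zero_eq_sum (Nat.zero_le n) (integrable_inner_of_memLp hF hΨ2),
    integral_cube_zero_eq_sum (Nat.zero_le n) (integrable_norm_sq_of_memLp hF),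
    integral_cube_zero_eq_sum (Nat.zero_le n) hD, pairing, ← Finset.sum_sub_distrib, Finset.mul_sum]
  refine abs_sum_le_sqrt_mul_sqrt _ (fun k _ => integral_nonneg fun _ => by positivity)
    (fun k _ => mul_nonneg hc (integral_nonneg fun _ => by positivity)) fun k hk => ?_
  have hFk := hF.mono_measure (hsub k hk)
  have hΨk := hΨ2.mono_measure (hsub k hk)
  set Q := cube (latticePt 0 k) 0 with hQ
  have e : (∫ x in Q, inner ℝ (F x) (Ψ x)) - inner ℝ (∫ x in Q, F x) (⨍ x in Q, Ψ x) =
      ∫ x in Q, inner ℝ (F x) (Ψ x - ⨍ y in Q, Ψ y) := by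
    simp only [inner_sub_right]
    rw [integral_sub (integrable_inner_of_memLp hFk hΨk)
      (integrable_inner_of_memLp hFk (memLp_const _))]
    congr 1
    simp only [real_inner_comm (⨍ y in Q, Ψ y)]
    rw [integral_inner (hFk.integrable (by norm_num))]
  rw [e]
  refine (abs_integral_inner_le hFk (hΨk.sub (memLp_const _))).trans ?_
  gcongr
  have := integral_norm_sub_setAverage_sq_le fun i =>
    (hΨ i).mono (latticePt_subcube_subset (Nat.zero_le n) hk)
  simpa using this

/-- Splitting the integral of `F` over each parent into its children writes the difference as a sum
over children of the integral of `F` against the mean of `Ψ` on the child minus that on the parent.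
Cauchy–Schwarz over the children and the Poincaré inequality on the parents conclude. -/
theorem abs_pairing_sub_pairing_succ_le {m : ℕ} (hm : m + 1 ≤ n)
    (hF : MemLp F 2 (volume.restrict (cube 0 n)))
    (hΨ : ∀ i, IsH1 (cube 0 n) (fun x => Ψ x i) (D i)) :
    |pairing F Ψ n m - pairing F Ψ n (m + 1)| ≤
      Real.sqrt ((3 ^ n) ^ d) * meanNorm F n m *
        Real.sqrt (poincareConst d * (3 ^ (m + 1)) ^ 2 *
          ∫ x in cube 0 n, ∑ i, ‖D i x‖ ^ 2) := by
  have hΨ2 : MemLp Ψ 2 (volume.restrict (cube 0 n)) := memLp_of_forall_apply fun i => (hΨ i).1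
  have hD : Integrable (fun x => ∑ i, ‖D i x‖ ^ 2) (volume.restrict (cube 0 n)) :=
    integrable_finsetSum _ fun i _ => integrable_norm_sq_of_memLp (hΨ i).2.1
  have hc : 0 ≤ poincareConst d := by unfold poincareConst; positivity
  have hRsub := fun l (hl : l ∈ subcubes d n (m + 1)) =>
    Measure.restrict_mono_set volume (latticePt_subcube_subset hm hl)
  have hQsub := fun (l j : Fin d → ℤ) (hj : j ∈ subcubes d (m + 1) m) =>
    subcube_subset (Nat.le_succ m) (latticePt (m + 1) l) hj
  have hQs := fun l j (hj : j ∈ subcubes d (m + 1) m) =>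
    Measure.restrict_mono_set volume (hQsub l j hj)
  set c : (Fin d → ℤ) → E d := fun l => ⨍ x in cube (latticePt (m + 1) l) (m + 1), Ψ x with hcdef
  set Q : (Fin d → ℤ) → (Fin d → ℤ) → Set (E d) := fun l j =>
    cube (latticePt (m + 1) l + latticePt m j) m with hQ
  have hint : ∀ l ∈ subcubes d n (m + 1),
      IntegrableOn (fun x => ‖Ψ x - c l‖ ^ 2) (cube (latticePt (m + 1) l) (m + 1)) := fun l hl =>
    integrable_norm_sq_of_memLp ((hΨ2.mono_measure (hRsub l hl)).sub (memLp_const _))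
  have e1 : pairing F Ψ n m - pairing F Ψ n (m + 1) =
      ∑ q ∈ subcubes d n (m + 1) ×ˢ subcubes d (m + 1) m,
        inner ℝ (∫ x in Q q.1 q.2, F x) ((⨍ x in Q q.1 q.2, Ψ x) - c q.1) := by
    rw [pairing, pairing, sum_subcubes_succ hm, ← Finset.sum_sub_distrib,
      Finset.sum_product' (f := fun l j =>
        inner ℝ (∫ x in Q l j, F x) ((⨍ x in Q l j, Ψ x) - c l))]
    refine Finset.sum_congr rfl fun l hl => ?_
    rw [integral_cube_eq_sum (Nat.le_succ m) (latticePt (m + 1) l)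
      ((hF.mono_measure (hRsub l hl)).integrable (by norm_num)), sum_inner,
      ← Finset.sum_sub_distrib]
    refine Finset.sum_congr rfl fun j hj => ?_
    rw [inner_sub_right, hQ]
    simp only [latticePt_succ_add]
    rfl
  have e2 : ∑ k ∈ subcubes d n m, ((3 : ℝ) ^ m) ^ d * ‖⨍ x in cube (latticePt m k) m, F x‖ ^ 2 =
      ∑ q ∈ subcubes d n (m + 1) ×ˢ subcubes d (m + 1) m,
        ((3 : ℝ) ^ m) ^ d * ‖⨍ x in Q q.1 q.2, F x‖ ^ 2 := by
    rw [sum_subcubes_succ hm, Finset.sum_product' (f := fun l j =>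
        ((3 : ℝ) ^ m) ^ d * ‖⨍ x in Q l j, F x‖ ^ 2)]
    simp only [hQ, latticePt_succ_add]
  have e3 : ∑ q ∈ subcubes d n (m + 1) ×ˢ subcubes d (m + 1) m,
      ∫ x in Q q.1 q.2, ‖Ψ x - c q.1‖ ^ 2 ≤
      poincareConst d * (3 ^ (m + 1)) ^ 2 * ∫ x in cube 0 n, ∑ i, ‖D i x‖ ^ 2 := by
    rw [Finset.sum_product' (f := fun l j => ∫ x in Q l j, ‖Ψ x - c l‖ ^ 2),
      integral_cube_zero_eq_sum hm hD, Finset.mul_sum]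
    refine Finset.sum_le_sum fun l hl => ?_
    rw [← integral_cube_eq_sum (Nat.le_succ m) (latticePt (m + 1) l) (hint l hl)]
    exact integral_norm_sub_setAverage_sq_le fun i =>
      (hΨ i).mono (latticePt_subcube_subset hm hl)
  rw [← sqrt_sum_mean_sq (by omega) F, e1, e2]
  have key := abs_sum_le_sqrt_mul_sqrt (subcubes d n (m + 1) ×ˢ subcubes d (m + 1) m)
    (f := fun q => inner ℝ (∫ x in Q q.1 q.2, F x) ((⨍ x in Q q.1 q.2, Ψ x) - c q.1))
    (a := fun q => ((3 : ℝ) ^ m) ^ d * ‖⨍ x in Q q.1 q.2, F x‖ ^ 2)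
    (b := fun q => ∫ x in Q q.1 q.2, ‖Ψ x - c q.1‖ ^ 2)
    (fun q _ => mul_nonneg (by positivity) (sq_nonneg _))
    (fun q _ => integral_nonneg fun _ => sq_nonneg _)
    (fun q hq => abs_inner_integral_sub_le F ((hΨ2.mono_measure
      (hRsub q.1 (Finset.mem_product.1 hq).1)).mono_measure
        (hQs q.1 q.2 (Finset.mem_product.1 hq).2)) (c q.1))
  exact key.trans (mul_le_mul_of_nonneg_left (Real.sqrt_le_sqrt e3) (Real.sqrt_nonneg _))

theorem subcubes_self (n : ℕ) : subcubes d n n = {0} := by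
  ext k
  have h := mem_subcubes_add (d := d) (m := n) (j := 0) (k := k)
  rw [Nat.add_zero] at h
  rw [h, Finset.mem_singleton, funext_iff]
  refine forall_congr' fun i => ?_
  simp only [pow_zero, Pi.zero_apply]
  omega

theorem latticePt_zero (m : ℕ) : latticePt m (0 : Fin d → ℤ) = 0 := by
  ext i
  simp [latticePt_apply]

/-- Nothing is subtracted at the largest scale, so this term is controlled by the `L²` part of the
norm of `Ψ`, whose weight is `|□_n|^(-1/d) = 3^(-n)`. -/
theorem abs_pairing_self_le
    (hΨ : MemLp Ψ 2 (volume.restrict (cube 0 n))) :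
    |pairing F Ψ n n| ≤
      Real.sqrt ((3 ^ n) ^ d) * meanNorm F n n * Real.sqrt (∫ x in cube 0 n, ‖Ψ x‖ ^ 2) := by
  rw [← sqrt_sum_mean_sq le_rfl F, pairing, subcubes_self, Finset.sum_singleton,
    Finset.sum_singleton, latticePt_zero]
  simpa using abs_inner_integral_sub_le F hΨ 0

theorem normL2_cube {z : E d} (f : E d → ℝ) :
    Real.sqrt ((3 ^ n) ^ d) * normL2 (cube z n) f = Real.sqrt (∫ x in cube z n, f x ^ 2) := by
  have hV : (0 : ℝ) < (3 ^ n) ^ d := by positivity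
  rw [normL2, setAverage_cube, smul_eq_mul, ← Real.sqrt_mul hV.le, mul_inv_cancel_left₀ hV.ne']

theorem abs_setAverage_inner_le_of_normH1_le_one (hd : 1 ≤ d)
    (hF : MemLp F 2 (volume.restrict (cube 0 n)))
    (hΨ : ∀ i, IsH1 (cube 0 n) (fun x => Ψ x i) (D i)) (h1 : normH1 (cube 0 n) Ψ D ≤ 1) :
    |⨍ x in cube 0 n, inner ℝ (F x) (Ψ x)| ≤ 3 * Real.sqrt (poincareConst d) *
      (normL2 (cube 0 n) (fun x => ‖F x‖) +
        ∑ m ∈ Finset.range (n + 1), 3 ^ m * meanNorm F n m) := by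
  have hV : (0 : ℝ) < (3 ^ n) ^ d := by positivity
  have hΨ2 : MemLp Ψ 2 (volume.restrict (cube 0 n)) := memLp_of_forall_apply fun i => (hΨ i).1
  set S := Real.sqrt ((3 ^ n) ^ d) with hS
  have hS0 : 0 ≤ S := Real.sqrt_nonneg _
  set c := Real.sqrt (poincareConst d) with hc
  have hd' : (1 : ℝ) ≤ d := by exact_mod_cast hd
  -- This lets the top-scale term, which carries no Poincaré constant, share the prefactor `3 c` of
  -- the other scales.
  have hcp : 1 ≤ poincareConst d := by
    unfold poincareConst
    nlinarith [one_le_pow₀ (M₀ := ℝ) (a := 3) (n := d) (by norm_num)]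
  have hc1 : 1 ≤ c := Real.one_le_sqrt.2 hcp
  have hf : ∀ m, 0 ≤ meanNorm F n m := fun m => Real.sqrt_nonneg _
  have hN0 : ∀ f : E d → ℝ, 0 ≤ normL2 (cube 0 n) f := fun f => Real.sqrt_nonneg _
  have hvol : (volume (cube (0 : E d) n)).toReal ^ (-(1 / (d : ℝ))) = (3 ^ n)⁻¹ := by
    rw [volume_cube_toReal, Real.rpow_neg (by positivity), one_div,
      Real.pow_rpow_inv_natCast (by positivity) (by omega)]
  rw [normH1, hvol] at h1
  have hΨn : normL2 (cube 0 n) (fun x => ‖Ψ x‖) ≤ 3 ^ n := by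
    have h3 : (0 : ℝ) < 3 ^ n := by positivity
    have : (3 ^ n)⁻¹ * normL2 (cube 0 n) (fun x => ‖Ψ x‖) ≤ 1 :=
      le_trans (le_add_of_nonneg_right (hN0 _)) h1
    rwa [inv_mul_le_iff₀ h3, mul_one] at this
  have hDn : normL2 (cube 0 n) (fun x => Real.sqrt (∑ i, ‖D i x‖ ^ 2)) ≤ 1 :=
    le_trans (le_add_of_nonneg_left (mul_nonneg (by positivity) (hN0 _))) h1
  have hDi : Real.sqrt (∫ x in cube 0 n, ∑ i, ‖D i x‖ ^ 2) ≤ S := by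
    have e := normL2_cube (n := n) (z := 0) (fun x => Real.sqrt (∑ i, ‖D i x‖ ^ 2))
    simp only [Real.sq_sqrt (Finset.sum_nonneg fun i _ => sq_nonneg _)] at e
    rw [← e]
    exact mul_le_of_le_one_right hS0 hDn
  have hD0 : 0 ≤ ∫ x in cube 0 n, ∑ i, ‖D i x‖ ^ 2 := integral_nonneg fun _ => by positivity
  have hΨi : Real.sqrt (∫ x in cube 0 n, ‖Ψ x‖ ^ 2) ≤ S * 3 ^ n := by
    rw [← normL2_cube]
    gcongr
  have b1 := abs_integral_sub_pairing_le hF hΨ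
  have b1' : |(∫ x in cube 0 n, inner ℝ (F x) (Ψ x)) - pairing F Ψ n 0| ≤
      S * normL2 (cube 0 n) (fun x => ‖F x‖) * (c * S) := by
    refine b1.trans ?_
    rw [← normL2_cube, Real.sqrt_mul (by linarith)]
    gcongr
    exact mul_nonneg hS0 (hN0 _)
  have b2 : ∀ m ∈ Finset.range n, |pairing F Ψ n m - pairing F Ψ n (m + 1)| ≤
      S * S * c * (3 * (3 ^ m * meanNorm F n m)) := by
    intro m hm
    refine (abs_pairing_sub_pairing_succ_le (Finset.mem_range.1 hm) hF hΨ).trans ?_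
    rw [Real.sqrt_mul (by positivity), Real.sqrt_mul (by linarith),
      Real.sqrt_sq (by positivity)]
    calc _ ≤ S * meanNorm F n m * (c * 3 ^ (m + 1) * S) := by
          gcongr
          exact mul_nonneg hS0 (hf m)
      _ = _ := by rw [pow_succ]; ring
  have b3 : |pairing F Ψ n n| ≤ S * S * c * (3 * (3 ^ n * meanNorm F n n)) := by
    refine (abs_pairing_self_le hΨ2).trans ?_
    have h0 : 0 ≤ S * S * (3 ^ n * meanNorm F n n) :=
      mul_nonneg (mul_nonneg hS0 hS0) (mul_nonneg (by positivity) (hf n))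
    calc _ ≤ S * meanNorm F n n * (S * 3 ^ n) := by
          gcongr
          exact mul_nonneg hS0 (hf n)
      _ = S * S * (3 ^ n * meanNorm F n n) * 1 := by ring
      _ ≤ S * S * (3 ^ n * meanNorm F n n) * (3 * c) := by gcongr; linarith
      _ = _ := by ring
  have tel : pairing F Ψ n 0 =
      (∑ m ∈ Finset.range n, (pairing F Ψ n m - pairing F Ψ n (m + 1))) + pairing F Ψ n n := by
    rw [Finset.sum_range_sub']
    ring
  have hSS : S * S = (3 ^ n) ^ d := Real.mul_self_sqrt hV.le
  rw [setAverage_cube, smul_eq_mul, abs_mul, abs_of_nonneg (inv_nonneg.2 hV.le),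
    inv_mul_le_iff₀ hV, ← hSS]
  calc |∫ x in cube 0 n, inner ℝ (F x) (Ψ x)|
      = |((∫ x in cube 0 n, inner ℝ (F x) (Ψ x)) - pairing F Ψ n 0) +
          ((∑ m ∈ Finset.range n, (pairing F Ψ n m - pairing F Ψ n (m + 1))) +
            pairing F Ψ n n)| := by rw [← tel]; congr 1; ring
    _ ≤ |(∫ x in cube 0 n, inner ℝ (F x) (Ψ x)) - pairing F Ψ n 0| +
          ((∑ m ∈ Finset.range n, |pairing F Ψ n m - pairing F Ψ n (m + 1)|) +
            |pairing F Ψ n n|) :=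
        (abs_add_le _ _).trans (add_le_add_right ((abs_add_le _ _).trans
          (add_le_add_left (Finset.abs_sum_le_sum_abs _ _) _)) _)
    _ ≤ S * normL2 (cube 0 n) (fun x => ‖F x‖) * (c * S) +
          ((∑ m ∈ Finset.range n, S * S * c * (3 * (3 ^ m * meanNorm F n m))) +
            S * S * c * (3 * (3 ^ n * meanNorm F n n))) :=
        add_le_add b1' (add_le_add (Finset.sum_le_sum b2) b3)
    _ = S * S * c * (normL2 (cube 0 n) (fun x => ‖F x‖) +
          3 * ∑ m ∈ Finset.range (n + 1), 3 ^ m * meanNorm F n m) := by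
        rw [Finset.sum_range_succ, ← Finset.mul_sum, ← Finset.mul_sum]
        ring
    _ ≤ S * S * c * (3 * normL2 (cube 0 n) (fun x => ‖F x‖) +
          3 * ∑ m ∈ Finset.range (n + 1), 3 ^ m * meanNorm F n m) := by
        gcongr
        linarith [hN0 fun x => ‖F x‖]
    _ = _ := by ring

/-- The multiscale Poincaré inequality, in dual form. -/
theorem normHhat_le (hd : 1 ≤ d) (hF : MemLp F 2 (volume.restrict (cube 0 n))) :
    normHhat (cube 0 n) F ≤ ENNReal.ofReal (3 * Real.sqrt (poincareConst d) *
      (normL2 (cube 0 n) (fun x => ‖F x‖) +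
        ∑ m ∈ Finset.range (n + 1), 3 ^ m * meanNorm F n m)) := by
  refine iSup_le fun Ψ => iSup_le fun D => iSup_le fun hΨ => iSup_le fun h1 => ?_
  exact ENNReal.ofReal_le_ofReal ((le_abs_self _).trans
    (abs_setAverage_inner_le_of_normH1_le_one hd hF hΨ h1))

end

/-! ### Elliptic coefficients -/

theorem app_apply (A : Mat d) (x : E d) (i : Fin d) : app A x i = ∑ j, A i j * x j := by
  rw [app, Matrix.ofLp_toEuclideanCLM]
  rfl

theorem app_add (A : Mat d) (x y : E d) : app A (x + y) = app A x + app A y := map_add _ _ _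

theorem app_sub (A : Mat d) (x y : E d) : app A (x - y) = app A x - app A y := map_sub _ _ _

theorem app_smul (A : Mat d) (c : ℝ) (x : E d) : app A (c • x) = c • app A x := map_smul _ _ _

theorem norm_app_le (A : Mat d) (x : E d) : ‖app A x‖ ≤ opNorm A * ‖x‖ :=
  ContinuousLinearMap.le_opNorm _ _

theorem app_sub_left (A B : Mat d) (x : E d) : app (A - B) x = app A x - app B x := by
  simp only [app, map_sub]
  rfl

/-- The symmetric matrix `A` satisfies `lam ≤ A ≤ Lam`. -/
structure IsEllipticMat (lam Lam : ℝ) (A : Mat d) : Prop where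
  symm : ∀ x y, form A x y = form A y x
  lower : ∀ x, lam * ‖x‖ ^ 2 ≤ form A x x
  upper : ∀ x, form A x x ≤ Lam * ‖x‖ ^ 2

/-- Expand the nonnegative form at `x - Lam⁻¹ • A x`. Thus fluxes are bounded in `L²` by energies at
the price of one factor `Lam`. -/
theorem IsEllipticMat.norm_app_sq_le {lam Lam : ℝ} (h0 : 0 ≤ lam) (hL : 0 < Lam) {A : Mat d}
    (h : IsEllipticMat lam Lam A) (x : E d) : ‖app A x‖ ^ 2 ≤ Lam * form A x x := by
  set y := app A x with hy
  have hyx : form A y x = ‖y‖ ^ 2 := real_inner_self_eq_norm_sq y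
  have hxy : form A x y = ‖y‖ ^ 2 := by rw [h.symm, hyx]
  have h1 : 0 ≤ form A (x - Lam⁻¹ • y) (x - Lam⁻¹ • y) :=
    le_trans (by positivity) (h.lower _)
  have h2 : form A (x - Lam⁻¹ • y) (x - Lam⁻¹ • y) =
      form A x x - Lam⁻¹ * form A x y - Lam⁻¹ * form A y x + Lam⁻¹ ^ 2 * form A y y := by
    simp only [form, app_sub, app_smul, inner_sub_left, inner_sub_right, inner_smul_left,
      inner_smul_right]
    simp
    ring
  have h3 : Lam⁻¹ ^ 2 * form A y y ≤ Lam⁻¹ * ‖y‖ ^ 2 := by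
    calc _ ≤ Lam⁻¹ ^ 2 * (Lam * ‖y‖ ^ 2) := by gcongr; exact h.upper y
      _ = _ := by field_simp
  rw [h2, hxy, hyx] at h1
  have h4 : Lam⁻¹ * ‖y‖ ^ 2 ≤ form A x x := by linarith
  rwa [inv_mul_le_iff₀ hL] at h4

/-- The coefficients `a` are measurable, symmetric and satisfy `lam ≤ a ≤ Lam` in `U`. -/
structure IsEllipticOn (a : E d → Mat d) (U : Set (E d)) (lam Lam : ℝ) : Prop where
  meas : ∀ i j, AEMeasurable (fun x => a x i j) (volume.restrict U)
  pos : 0 < lam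
  le : lam ≤ Lam
  ae : ∀ᵐ x ∂volume.restrict U, IsEllipticMat lam Lam (a x)

namespace IsEllipticOn

variable {a : E d → Mat d} {U V : Set (E d)} {lam Lam : ℝ} {F G : E d → E d}

theorem mono (h : IsEllipticOn a U lam Lam) (hVU : V ⊆ U) : IsEllipticOn a V lam Lam :=
  ⟨fun i j => (h.meas i j).mono_measure (Measure.restrict_mono_set _ hVU), h.pos, h.le,
    ae_mono (Measure.restrict_mono_set _ hVU) h.ae⟩

theorem memLp_app (h : IsEllipticOn a U lam Lam) (hF : MemLp F 2 (volume.restrict U)) :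
    MemLp (fun x => app (a x) (F x)) 2 (volume.restrict U) := by
  have hL : 0 < Lam := h.pos.trans_le h.le
  refine MemLp.of_le_mul (c := Lam) hF ?_ ?_
  · have e : (fun x => app (a x) (F x)) =
        fun x => ∑ i, (∑ j, a x i j * F x j) • basisVec i := by
      funext x
      ext k
      simp [basisVec, Finset.sum_apply, Pi.single_apply, app_apply]
    rw [e]
    refine Finset.aestronglyMeasurable_fun_sum _ fun i _ =>
      (Finset.aestronglyMeasurable_fun_sum _ fun j _ => ?_).smul_const _
    exact (h.meas i j).aestronglyMeasurable.mul
      ((EuclideanSpace.proj (𝕜 := ℝ) j).continuous.comp_aestronglyMeasurable hF.1)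
  · filter_upwards [h.ae] with x hx
    refine le_of_sq_le_sq ?_ (by positivity)
    calc ‖app (a x) (F x)‖ ^ 2 ≤ Lam * form (a x) (F x) (F x) := hx.norm_app_sq_le h.pos.le (h.pos.trans_le h.le) _
      _ ≤ Lam * (Lam * ‖F x‖ ^ 2) := by gcongr; exact hx.upper _
      _ = _ := by ring

theorem integrable_form (h : IsEllipticOn a U lam Lam) (hF : MemLp F 2 (volume.restrict U))
    (hG : MemLp G 2 (volume.restrict U)) :
    Integrable (fun x => form (a x) (F x) (G x)) (volume.restrict U) :=
  integrable_inner_of_memLp hF (h.memLp_app hG)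

theorem lower_integral (h : IsEllipticOn a U lam Lam) (hF : MemLp F 2 (volume.restrict U)) :
    lam * ∫ x in U, ‖F x‖ ^ 2 ≤ ∫ x in U, form (a x) (F x) (F x) := by
  rw [← integral_const_mul]
  refine integral_mono_ae ((integrable_norm_sq_of_memLp hF).const_mul _) (h.integrable_form hF hF) ?_
  filter_upwards [h.ae] with x hx using hx.lower _

theorem upper_integral (h : IsEllipticOn a U lam Lam) (hF : MemLp F 2 (volume.restrict U)) :
    ∫ x in U, form (a x) (F x) (F x) ≤ Lam * ∫ x in U, ‖F x‖ ^ 2 := by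
  rw [← integral_const_mul]
  refine integral_mono_ae (h.integrable_form hF hF) ((integrable_norm_sq_of_memLp hF).const_mul _) ?_
  filter_upwards [h.ae] with x hx using hx.upper _

theorem integral_norm_app_sq_le (h : IsEllipticOn a U lam Lam)
    (hF : MemLp F 2 (volume.restrict U)) :
    ∫ x in U, ‖app (a x) (F x)‖ ^ 2 ≤ Lam * ∫ x in U, form (a x) (F x) (F x) := by
  rw [← integral_const_mul]
  refine integral_mono_ae (integrable_norm_sq_of_memLp (h.memLp_app hF))
    ((h.integrable_form hF hF).const_mul _) ?_
  filter_upwards [h.ae] with x hx using hx.norm_app_sq_le h.pos.le (h.pos.trans_le h.le) _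

theorem integral_form_comm (h : IsEllipticOn a U lam Lam) (F G : E d → E d) :
    ∫ x in U, form (a x) (F x) (G x) = ∫ x in U, form (a x) (G x) (F x) := by
  refine integral_congr_ae ?_
  filter_upwards [h.ae] with x hx using hx.symm _ _

/-- Multiplication by the coefficients, as an operator on square-integrable vector fields. -/
def mulOp (h : IsEllipticOn a U lam Lam) :
    Lp (E d) 2 (volume.restrict U) →L[ℝ] Lp (E d) 2 (volume.restrict U) :=
  LinearMap.mkContinuous
    { toFun := fun f => (h.memLp_app (Lp.memLp f)).toLp
      map_add' := fun f g => by
        rw [← MemLp.toLp_add]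
        refine MemLp.toLp_congr _ _ ?_
        filter_upwards [Lp.coeFn_add f g] with x hx
        rw [hx, Pi.add_apply, app_add]
        rfl
      map_smul' := fun c f => by
        rw [RingHom.id_apply, ← MemLp.toLp_const_smul]
        refine MemLp.toLp_congr _ _ ?_
        filter_upwards [Lp.coeFn_smul c f] with x hx
        rw [hx, Pi.smul_apply, app_smul]
        rfl } Lam
    (fun f => by
      have hL : 0 < Lam := h.pos.trans_le h.le
      refine le_of_sq_le_sq ?_ (by positivity)
      have h1 := norm_toLp_sq (Lp.memLp f)
      rw [Lp.toLp_coeFn] at h1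
      change ‖(h.memLp_app (Lp.memLp f)).toLp‖ ^ 2 ≤ _
      rw [norm_toLp_sq, mul_pow, h1]
      calc _ ≤ Lam * ∫ x in U, form (a x) (f x) (f x) := h.integral_norm_app_sq_le (Lp.memLp f)
        _ ≤ Lam * (Lam * ∫ x in U, ‖f x‖ ^ 2) := by
          gcongr
          exact h.upper_integral (Lp.memLp f)
        _ = _ := by ring)

theorem mulOp_toLp (h : IsEllipticOn a U lam Lam) (hF : MemLp F 2 (volume.restrict U)) :
    h.mulOp (hF.toLp F) = (h.memLp_app hF).toLp := by
  change (h.memLp_app (Lp.memLp (hF.toLp F))).toLp = _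
  refine MemLp.toLp_congr _ _ ?_
  filter_upwards [hF.coeFn_toLp] with x hx
  rw [hx]

theorem inner_mulOp_toLp (h : IsEllipticOn a U lam Lam) (hF : MemLp F 2 (volume.restrict U))
    (hG : MemLp G 2 (volume.restrict U)) :
    inner ℝ (hF.toLp F) (h.mulOp (hG.toLp G)) = ∫ x in U, form (a x) (F x) (G x) := by
  rw [mulOp_toLp, inner_toLp]
  rfl

theorem mulOp_symm (h : IsEllipticOn a U lam Lam) (f g : Lp (E d) 2 (volume.restrict U)) :
    inner ℝ f (h.mulOp g) = inner ℝ g (h.mulOp f) := by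
  have h1 := h.inner_mulOp_toLp (Lp.memLp f) (Lp.memLp g)
  have h2 := h.inner_mulOp_toLp (Lp.memLp g) (Lp.memLp f)
  rw [Lp.toLp_coeFn, Lp.toLp_coeFn] at h1 h2
  rw [h1, h2, h.integral_form_comm]

theorem mulOp_coercive (h : IsEllipticOn a U lam Lam) (f : Lp (E d) 2 (volume.restrict U)) :
    lam * ‖f‖ ^ 2 ≤ inner ℝ f (h.mulOp f) := by
  have h1 := h.inner_mulOp_toLp (Lp.memLp f) (Lp.memLp f)
  have h2 := norm_toLp_sq (Lp.memLp f)
  rw [Lp.toLp_coeFn] at h1 h2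
  rw [h1, h2]
  exact h.lower_integral (Lp.memLp f)

end IsEllipticOn

/-! ### Minimization of a coercive quadratic form over an affine subspace -/

/-- Lax–Milgram on `V`. The solution operator is linear in `P`, which later makes the minimizer
linear in its slope. -/
theorem exists_corrector {H : Type*} [NormedAddCommGroup H] [InnerProductSpace ℝ H]
    [CompleteSpace H] (T : H →L[ℝ] H) {lam : ℝ} (hlam : 0 < lam)
    (hT : ∀ f, lam * ‖f‖ ^ 2 ≤ inner ℝ f (T f)) (V : Submodule ℝ H) (hV : IsClosed (V : Set H)) :
    ∃ S : H →ₗ[ℝ] H, ∀ P, S P - P ∈ V ∧ ∀ k ∈ V, inner ℝ k (T (S P)) = 0 := by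
  have : CompleteSpace V := hV.completeSpace_coe
  let B : V →L[ℝ] V →L[ℝ] ℝ := (innerSL ℝ).bilinearComp (T.comp V.subtypeL) V.subtypeL
  have hB : IsCoercive B := ⟨lam, hlam, fun v => by
    have := hT v
    rw [real_inner_comm] at this
    calc lam * ‖v‖ * ‖v‖ = lam * ‖(v : H)‖ ^ 2 := by rw [Submodule.coe_norm]; ring
      _ ≤ _ := this⟩
  let e := hB.continuousLinearEquivOfBilin
  have he : ∀ v w : V, inner ℝ (e v) w = inner ℝ (T v) (w : H) := fun v w =>
    hB.continuousLinearEquivOfBilin_apply v w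
  -- `R P` is the element of `V` with `⟨T (R P), k⟩ = ⟨T P, k⟩` for every `k ∈ V`; then `S = id -
  -- R`.
  let R : H →ₗ[ℝ] V :=
    e.symm.toLinearEquiv.toLinearMap.comp
      ((V.orthogonalProjectionOnto : H →L[ℝ] V).toLinearMap.comp T.toLinearMap)
  refine ⟨LinearMap.id - V.subtype.comp R, fun P => ⟨?_, fun k hk => ?_⟩⟩
  · simp
  · have h1 : inner ℝ (T (R P : H)) k = inner ℝ (T P) k := by
      rw [← he (R P) ⟨k, hk⟩]
      have : e (R P) = V.orthogonalProjectionOnto (T P) := e.apply_symm_apply _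
      rw [this, Submodule.coe_inner]
      exact Submodule.inner_orthogonalProjectionOnto_eq_of_mem_right ⟨k, hk⟩ (T P)
    rw [real_inner_comm]
    simp only [LinearMap.sub_apply, LinearMap.id_apply, LinearMap.comp_apply,
      Submodule.subtype_apply, map_sub, inner_sub_left]
    rw [h1, sub_self]

/-! ### Potential and solenoidal fields -/

theorem inner_gradient_apply (φ : E d → ℝ) (x y : E d) :
    inner ℝ y (gradient φ x) = fderiv ℝ φ x y := by
  rw [real_inner_comm, inner_gradient_left]

theorem gradient_apply (φ : E d → ℝ) (x : E d) (i : Fin d) :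
    gradient φ x i = fderiv ℝ φ x (basisVec i) := by
  rw [← inner_gradient_apply, basisVec, EuclideanSpace.inner_single_left]
  simp

namespace IsTest

variable {U : Set (E d)} {φ ψ : E d → ℝ}

theorem continuous_gradient (h : IsTest U φ) : Continuous (gradient φ) :=
  (InnerProductSpace.toDual ℝ (E d)).symm.continuous.comp h.continuous_fderiv

theorem hasCompactSupport_gradient (h : IsTest U φ) : HasCompactSupport (gradient φ) :=
  (h.2.1.fderiv ℝ).comp_left (g := (InnerProductSpace.toDual ℝ (E d)).symm) (map_zero _)

theorem memLp_gradient (h : IsTest U φ) (μ : Measure (E d)) [IsFiniteMeasureOnCompacts μ] :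
    MemLp (gradient φ) 2 μ :=
  h.continuous_gradient.memLp_of_hasCompactSupport h.hasCompactSupport_gradient

theorem gradient_add (h : IsTest U φ) (h' : IsTest U ψ) :
    gradient (fun x => φ x + ψ x) = gradient φ + gradient ψ := by
  funext x
  have : fderiv ℝ (fun x => φ x + ψ x) x = fderiv ℝ φ x + fderiv ℝ ψ x :=
    fderiv_add (h.differentiable x) (h'.differentiable x)
  simp only [gradient, this, map_add, Pi.add_apply]

theorem gradient_const_mul (h : IsTest U φ) (c : ℝ) :
    gradient (fun x => c * φ x) = c • gradient φ := by
  funext x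
  have : fderiv ℝ (fun x => c * φ x) x = c • fderiv ℝ φ x :=
    fderiv_const_mul (h.differentiable x) c
  simp only [gradient, this, map_smul, Pi.smul_apply]

theorem integral_mul_fderiv (hφ : IsTest U φ) {ψ : E d → ℝ} (hψ : Differentiable ℝ ψ)
    (hψ' : Continuous (fderiv ℝ ψ)) (y : E d) :
    ∫ x in U, ψ x * fderiv ℝ φ x y = -∫ x in U, fderiv ℝ ψ x y * φ x := by
  have e1 : ∫ x in U, ψ x * fderiv ℝ φ x y = ∫ x, ψ x * fderiv ℝ φ x y :=
    setIntegral_eq_integral_of_forall_compl_eq_zero fun x hx => by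
      rw [hφ.fderiv_eq_zero hx]; simp
  have e2 : ∫ x in U, fderiv ℝ ψ x y * φ x = ∫ x, fderiv ℝ ψ x y * φ x :=
    setIntegral_eq_integral_of_forall_compl_eq_zero fun x hx => by
      rw [hφ.eq_zero hx]; simp
  rw [e1, e2]
  refine integral_mul_fderiv_eq_neg_fderiv_mul_of_integrable ?_ ?_ ?_
    (fun x _ => hψ x) (fun x _ => hφ.differentiable x)
  · exact ((hψ'.clm_apply continuous_const).mul hφ.continuous).integrable_of_hasCompactSupport
      hφ.2.1.mul_left
  · exact (hψ.continuous.mul (hφ.continuous_fderiv.clm_apply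
      continuous_const)).integrable_of_hasCompactSupport (hφ.2.1.fderiv_apply ℝ y).mul_left
  · exact (hψ.continuous.mul hφ.continuous).integrable_of_hasCompactSupport hφ.2.1.mul_left

theorem isH10 (h : IsTest U φ) : IsH10 U φ (gradient φ) := by
  refine ⟨⟨h.memLp _, h.memLp_gradient _, fun ψ hψ i => ?_⟩, fun _ => φ, fun _ => h, ?_, ?_⟩
  · simp only [gradient_apply]
    exact hψ.integral_mul_fderiv h.differentiable h.continuous_fderiv _
  · simp
  · simp

end IsTest

/-- A square-integrable field that is orthogonal to the gradients of test functions. -/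
def IsSolenoidal (U : Set (E d)) (J : E d → E d) : Prop :=
  MemLp J 2 (volume.restrict U) ∧
    ∀ φ, IsTest U φ → ∫ x in U, inner ℝ (J x) (gradient φ x) = 0

/-- A square-integrable field that is orthogonal to all solenoidal fields. -/
def IsPotential (U : Set (E d)) (g : E d → E d) : Prop :=
  MemLp g 2 (volume.restrict U) ∧ ∀ J, IsSolenoidal U J → ∫ x in U, inner ℝ (J x) (g x) = 0

/-- A test function in `V` is one in `U`. This lets the flux of the large-scale minimizer be paired
with correctors in the subcubes. -/
theorem IsSolenoidal.mono {U V : Set (E d)} (hVU : V ⊆ U) {J : E d → E d}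
    (h : IsSolenoidal U J) : IsSolenoidal V J := by
  refine ⟨h.1.mono_measure (Measure.restrict_mono_set _ hVU), fun φ hφ => ?_⟩
  have e : ∀ W : Set (E d), V ⊆ W →
      ∫ x in W, inner ℝ (J x) (gradient φ x) = ∫ x, inner ℝ (J x) (gradient φ x) := fun W hW =>
    setIntegral_eq_integral_of_forall_compl_eq_zero fun x hx => by
      rw [inner_gradient_apply, hφ.fderiv_eq_zero fun h => hx (hW h)]; rfl
  rw [e V subset_rfl, ← e U hVU, h.2 φ (hφ.mono hVU)]

/-- Gradients of test functions have integral zero. Consequently potential fields have mean zero on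
`U`. -/
theorem isSolenoidal_const (U : Set (E d)) [IsFiniteMeasure (volume.restrict U)] (q : E d) :
    IsSolenoidal U fun _ => q := by
  refine ⟨memLp_const _, fun φ hφ => ?_⟩
  have := hφ.integral_mul_fderiv (ψ := fun _ => 1) (differentiable_const _)
    (by simp only [fderiv_fun_const]; exact continuous_const) q
  simpa [inner_gradient_apply] using this

/-- The gradients of the test functions in `U`. -/
def testGradients (U : Set (E d)) : Submodule ℝ (Lp (E d) 2 (volume.restrict U)) where
  carrier := {g | ∃ φ, IsTest U φ ∧ g =ᵐ[volume.restrict U] gradient φ}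
  zero_mem' := ⟨_, IsTest.zero, by
    filter_upwards [Lp.coeFn_zero (E d) 2 (volume.restrict U)] with x hx
    rw [hx]
    simp [gradient]⟩
  add_mem' := by
    rintro a b ⟨φ, hφ, ha⟩ ⟨ψ, hψ, hb⟩
    refine ⟨_, hφ.add hψ, ?_⟩
    rw [hφ.gradient_add hψ]
    exact (Lp.coeFn_add a b).trans (ha.add hb)
  smul_mem' := by
    rintro c a ⟨φ, hφ, ha⟩
    refine ⟨_, hφ.const_mul c, ?_⟩
    rw [hφ.gradient_const_mul]
    exact (Lp.coeFn_smul c a).trans (ha.const_smul c)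

theorem mem_testGradients_iff {U : Set (E d)} {g : Lp (E d) 2 (volume.restrict U)} :
    g ∈ testGradients U ↔ ∃ φ, ∃ hφ : IsTest U φ, g = (hφ.memLp_gradient _).toLp := by
  constructor
  · rintro ⟨φ, hφ, h⟩
    exact ⟨φ, hφ, Lp.ext (h.trans (MemLp.coeFn_toLp _).symm)⟩
  · rintro ⟨φ, hφ, rfl⟩
    exact ⟨φ, hφ, MemLp.coeFn_toLp _⟩

theorem inner_eq_zero_of_mem_closure {U : Set (E d)} {J : E d → E d} (hJ : IsSolenoidal U J)
    {g : Lp (E d) 2 (volume.restrict U)} (hg : g ∈ (testGradients U).topologicalClosure) :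
    inner ℝ (hJ.1.toLp J) g = 0 := by
  rw [← SetLike.mem_coe, Submodule.topologicalClosure_coe] at hg
  refine closure_minimal (t := {g | inner ℝ (hJ.1.toLp J) g = 0}) ?_
    (isClosed_eq (by fun_prop) continuous_const) hg
  intro g hg
  obtain ⟨φ, hφ, rfl⟩ := mem_testGradients_iff.1 hg
  rw [Set.mem_ofPred_eq, inner_toLp]
  exact hJ.2 φ hφ

theorem isPotential_of_mem_closure {U : Set (E d)} {g : E d → E d}
    (hg : MemLp g 2 (volume.restrict U))
    (h : hg.toLp ∈ (testGradients U).topologicalClosure) : IsPotential U g :=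
  ⟨hg, fun J hJ => by rw [← inner_toLp hJ.1 hg, inner_eq_zero_of_mem_closure hJ h]⟩

theorem IsH10.mem_closure {U : Set (E d)} {u : E d → ℝ} {G : E d → E d} (h : IsH10 U u G) :
    h.1.2.1.toLp ∈ (testGradients U).topologicalClosure := by
  obtain ⟨φ, hφ, -, hlim⟩ := h.2
  rw [← SetLike.mem_coe, Submodule.topologicalClosure_coe]
  refine mem_closure_of_tendsto (f := fun k => ((hφ k).memLp_gradient (volume.restrict U)).toLp)
    (b := atTop) ?_ (Eventually.of_forall fun k => mem_testGradients_iff.2 ⟨_, hφ k, rfl⟩)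
  rw [Lp.tendsto_Lp_iff_tendsto_eLpNorm'']
  refine hlim.congr fun k => ?_
  rw [← eLpNorm_neg]
  congr 1
  funext x
  simp

theorem IsTest.isAdmissible {U : Set (E d)} {φ : E d → ℝ} (h : IsTest U φ) (p : E d) :
    IsAdmissible U p (fun x => inner ℝ p x + φ x) (fun x => p + gradient φ x) := by
  have := h.isH10
  simpa [IsAdmissible] using this

/-! ### The cell problem -/

theorem energy_eq (a : E d → Mat d) (U : Set (E d)) (G : E d → E d) :
    energy a U G = (2 * volume.real U)⁻¹ * ∫ x in U, form (a x) (G x) (G x) := by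
  rw [energy, setAverage_eq, integral_const_mul, smul_eq_mul, mul_inv]
  ring

theorem IsAdmissible.memLp {U : Set (E d)} [IsFiniteMeasure (volume.restrict U)] {p : E d}
    {v : E d → ℝ} {G : E d → E d} (h : IsAdmissible U p v G) : MemLp G 2 (volume.restrict U) := by
  have := h.1.2.1.add (memLp_const p)
  refine this.ae_eq (ae_of_all _ fun x => ?_)
  simp

/-- A family of solutions of the cell problem in `U`. -/
structure IsCellFamily (a : E d → Mat d) (U : Set (E d)) (S : E d → E d → E d) : Prop where
  memLp : ∀ p, MemLp (S p) 2 (volume.restrict U)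
  potential : ∀ p, IsPotential U fun x => S p x - p
  solenoidal : ∀ p, IsSolenoidal U fun x => app (a x) (S p x)
  mu_eq : ∀ p, mu a U p = energy a U (S p)
  minimizer : ∀ p v G, IsMinimizer a U p v G → G =ᵐ[volume.restrict U] S p
  add : ∀ p q, S (p + q) =ᵐ[volume.restrict U] fun x => S p x + S q x
  smul : ∀ (c : ℝ) p, S (c • p) =ᵐ[volume.restrict U] fun x => c • S p x

set_option maxHeartbeats 1000000 in
-- The problem is solved for gradients in the closure of `testGradients U`, so no potential has to
-- be recovered from a limit of gradients. Density still identifies the resulting energy with the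
-- infimum `mu`, and coercivity identifies the gradient of any actual minimizer.
theorem IsEllipticOn.exists_isCellFamily {a : E d → Mat d} {U : Set (E d)} {lam Lam : ℝ}
    [IsFiniteMeasure (volume.restrict U)] (hU : 0 < volume.real U)
    (h : IsEllipticOn a U lam Lam) : ∃ S, IsCellFamily a U S := by
  set V := (testGradients U).topologicalClosure with hV
  obtain ⟨S, hS⟩ := exists_corrector h.mulOp h.pos h.mulOp_coercive V
    (Submodule.isClosed_topologicalClosure _)
  set c : E d →ₗ[ℝ] Lp (E d) 2 (volume.restrict U) := Lp.constₗ 2 (volume.restrict U) ℝ with hc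
  have hcp : ∀ p, c p = (memLp_const p : MemLp (fun _ => p) 2 (volume.restrict U)).toLp :=
    fun p => rfl
  have hm : ∀ p, MemLp (S (c p)) 2 (volume.restrict U) := fun p => Lp.memLp _
  have hto : ∀ p, (hm p).toLp = S (c p) := fun p => Lp.toLp_coeFn _ _
  have hen : ∀ {G : E d → E d} (hG : MemLp G 2 (volume.restrict U)),
      energy a U G = (2 * volume.real U)⁻¹ * inner ℝ hG.toLp (h.mulOp hG.toLp) := fun hG => by
    rw [h.inner_mulOp_toLp, energy_eq]
  -- Pythagoras for the form defined by `a`: the cross terms vanish because `S (c p)` is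
  -- `a`-orthogonal to `V`.
  have hsplit : ∀ p g, g - c p ∈ V → inner ℝ g (h.mulOp g) =
      inner ℝ (S (c p)) (h.mulOp (S (c p))) + inner ℝ (g - S (c p)) (h.mulOp (g - S (c p))) := by
    intro p g hg
    have h1 : g - S (c p) ∈ V := by
      have := V.sub_mem hg (hS (c p)).1
      simpa using this
    have h2 := (hS (c p)).2 _ h1
    have h3 : inner ℝ (S (c p)) (h.mulOp (g - S (c p))) = 0 := by rw [h.mulOp_symm, h2]
    have e : g = S (c p) + (g - S (c p)) := by abel
    conv_lhs => rw [e]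
    rw [map_add, inner_add_left, inner_add_right, inner_add_right, h2, h3]
    ring
  have hpos : ∀ f, 0 ≤ inner ℝ f (h.mulOp f) := fun f =>
    le_trans (mul_nonneg h.pos.le (by positivity)) (h.mulOp_coercive f)
  have hadm : ∀ p v G, IsAdmissible U p v G → ∀ hG : MemLp G 2 (volume.restrict U),
      hG.toLp - c p ∈ V := by
    intro p v G hadm hG
    have := hadm.mem_closure
    rw [hcp, ← MemLp.toLp_sub]
    exact this
  have hle : ∀ p v G, IsAdmissible U p v G → energy a U (S (c p)) ≤ energy a U G := by
    intro p v G hG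
    have h1 := hsplit p _ (hadm p v G hG hG.memLp)
    rw [hen (hm p), hen hG.memLp, hto, h1]
    gcongr
    exact le_add_of_nonneg_right (hpos _)
  -- The competitors `l_p + φ` with `φ` a test function have gradients dense in `c p + V`, and the
  -- energy is continuous, so a lower bound passes to `S (c p)`.
  have hlb : ∀ p b, (∀ v G, IsAdmissible U p v G → b ≤ energy a U G) →
      b ≤ energy a U (S (c p)) := by
    intro p b hb
    have hmem : S (c p) - c p ∈ closure (testGradients U : Set _) := by
      rw [← Submodule.topologicalClosure_coe]
      exact (hS (c p)).1
    have := closure_minimal (t := {g | b ≤ (2 * volume.real U)⁻¹ *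
      inner ℝ (c p + g) (h.mulOp (c p + g))}) ?_ (isClosed_le continuous_const (by fun_prop)) hmem
    · rw [Set.mem_ofPred_eq, add_sub_cancel] at this
      rwa [hen (hm p), hto]
    · intro g hg
      obtain ⟨φ, hφ, rfl⟩ := mem_testGradients_iff.1 hg
      have h1 := hb _ _ (hφ.isAdmissible p)
      have h2 : MemLp (fun x => p + gradient φ x) 2 (volume.restrict U) :=
        (memLp_const p).add (hφ.memLp_gradient _)
      rw [hen h2] at h1
      rw [Set.mem_ofPred_eq, hcp, ← MemLp.toLp_add]
      exact h1
  have hmu : ∀ p, mu a U p = energy a U (S (c p)) := by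
    intro p
    refine IsGLB.csInf_eq ⟨?_, ?_⟩ ⟨_, _, _, IsTest.zero.isAdmissible p, rfl⟩
    · rintro t ⟨v, G, hG, rfl⟩
      exact hle p v G hG
    · intro b hb
      exact hlb p b fun v G hG => hb ⟨v, G, hG, rfl⟩
  refine ⟨fun p => S (c p), hm, fun p => ?_, fun p => ⟨h.memLp_app (hm p), fun φ hφ => ?_⟩, hmu,
    fun p v G hG => ?_, fun p q => ?_, fun t p => ?_⟩
  · have h2 : MemLp (fun x => S (c p) x - p) 2 (volume.restrict U) := (hm p).sub (memLp_const p)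
    refine isPotential_of_mem_closure h2 ?_
    have := (hS (c p)).1
    rw [hcp] at this
    have e : h2.toLp = S (c p) - (memLp_const p : MemLp (fun _ => p) 2 (volume.restrict U)).toLp := by
      nth_rw 2 [← hto]
      rw [← MemLp.toLp_sub]
      rfl
    rw [e]
    exact this
  · have h1 := (hS (c p)).2 (hφ.memLp_gradient _).toLp
      (Submodule.le_topologicalClosure _ (mem_testGradients_iff.2 ⟨φ, hφ, rfl⟩))
    rw [← hto, h.inner_mulOp_toLp (hφ.memLp_gradient _) (hm p)] at h1
    rw [← h1]
    exact integral_congr_ae (ae_of_all _ fun x => real_inner_comm _ _)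
  -- The energy of a minimizer cannot exceed that of `S (c p)`; by the splitting, the energy of the
  -- difference vanishes.
  · have hGm := hG.1.memLp
    have h1 := hlb p _ hG.2
    rw [hen (hm p), hen hGm, hto, hsplit p _ (hadm p v G hG.1 hGm)] at h1
    have h2 := le_of_mul_le_mul_left h1 (by positivity)
    have h3 := h.mulOp_coercive (hGm.toLp - S (c p))
    have h4 : lam * ‖hGm.toLp - S (c p)‖ ^ 2 ≤ 0 := by linarith
    have h5 : ‖hGm.toLp - S (c p)‖ ^ 2 ≤ 0 :=
      not_lt.1 fun hne => absurd (mul_pos h.pos hne) (not_lt.2 h4)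
    have h6 : hGm.toLp = S (c p) := by
      rw [← sub_eq_zero, ← norm_eq_zero]
      exact pow_eq_zero_iff (two_ne_zero) |>.1 (le_antisymm h5 (sq_nonneg _))
    rw [← h6]
    exact hGm.coeFn_toLp.symm
  · rw [map_add, map_add]
    exact Lp.coeFn_add _ _
  · rw [map_smul, map_smul]
    exact Lp.coeFn_smul _ _

namespace IsCellFamily

variable {a : E d → Mat d} {U : Set (E d)} {lam Lam : ℝ} {S : E d → E d → E d}

/-- The source of all the energy identities: a solenoidal field does not distinguish `S p` from `p`.
It is used with `J` a constant, the flux of the same cell family, and the flux of the minimizer in a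
larger cube. -/
theorem integral_inner_eq (hS : IsCellFamily a U S) [IsFiniteMeasure (volume.restrict U)]
    {J : E d → E d} (hJ : IsSolenoidal U J) (p : E d) :
    ∫ x in U, inner ℝ (J x) (S p x) = ∫ x in U, inner ℝ (J x) p := by
  have h := (hS.potential p).2 J hJ
  simp only [inner_sub_right] at h
  rw [integral_sub (integrable_inner_of_memLp hJ.1 (hS.memLp p))
    (integrable_inner_of_memLp hJ.1 (memLp_const p))] at h
  linarith

theorem integral_form_eq (hS : IsCellFamily a U S) [IsFiniteMeasure (volume.restrict U)]
    (p q : E d) :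
    ∫ x in U, form (a x) (S q x) (S p x) = ∫ x in U, form (a x) q (S p x) := by
  have h := hS.integral_inner_eq (hS.solenoidal p) q
  simpa only [form, real_inner_comm] using h

theorem integral_form_left (hS : IsCellFamily a U S) [IsFiniteMeasure (volume.restrict U)]
    (p q : E d) :
    ∫ x in U, form (a x) q (S p x) = inner ℝ q (∫ x in U, app (a x) (S p x)) :=
  integral_inner ((hS.solenoidal p).1.integrable (by norm_num)) q

theorem integral_eq (hS : IsCellFamily a U S) [IsFiniteMeasure (volume.restrict U)]
    (p : E d) : ∫ x in U, S p x = volume.real U • p := by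
  refine ext_inner_left ℝ fun q => ?_
  rw [← integral_inner ((hS.memLp p).integrable (by norm_num)),
    hS.integral_inner_eq (isSolenoidal_const U q) p, integral_const,
    measureReal_restrict_apply MeasurableSet.univ, Set.univ_inter, inner_smul_right, smul_eq_mul]

theorem integral_app_add (hS : IsCellFamily a U S) [IsFiniteMeasure (volume.restrict U)]
    (p q : E d) : ∫ x in U, app (a x) (S (p + q) x) =
      (∫ x in U, app (a x) (S p x)) + ∫ x in U, app (a x) (S q x) := by
  rw [← integral_add ((hS.solenoidal p).1.integrable (by norm_num))
    ((hS.solenoidal q).1.integrable (by norm_num))]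
  refine integral_congr_ae ?_
  filter_upwards [hS.add p q] with x hx
  rw [hx, app_add]

theorem integral_app_smul (hS : IsCellFamily a U S) (t : ℝ) (p : E d) :
    ∫ x in U, app (a x) (S (t • p) x) = t • ∫ x in U, app (a x) (S p x) := by
  rw [← integral_smul]
  refine integral_congr_ae ?_
  filter_upwards [hS.smul t p] with x hx
  rw [hx, app_smul]

/-- The integral of the flux, as a linear function of the slope. -/
def flux (hS : IsCellFamily a U S) [IsFiniteMeasure (volume.restrict U)] : E d →ₗ[ℝ] E d where
  toFun p := ∫ x in U, app (a x) (S p x)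
  map_add' := hS.integral_app_add
  map_smul' := hS.integral_app_smul

theorem mu_eq_flux (hS : IsCellFamily a U S) [IsFiniteMeasure (volume.restrict U)] (p : E d) :
    mu a U p = (2 * volume.real U)⁻¹ * inner ℝ p (hS.flux p) := by
  rw [hS.mu_eq, energy_eq, hS.integral_form_eq, hS.integral_form_left]
  rfl

theorem inner_flux_comm (hS : IsCellFamily a U S) [IsFiniteMeasure (volume.restrict U)]
    (h : IsEllipticOn a U lam Lam) (p q : E d) :
    inner ℝ p (hS.flux q) = inner ℝ q (hS.flux p) := by
  have h1 := hS.integral_form_left q p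
  have h2 := hS.integral_form_left p q
  rw [← hS.integral_form_eq] at h1 h2
  change inner ℝ p (∫ x in U, app (a x) (S q x)) = inner ℝ q (∫ x in U, app (a x) (S p x))
  rw [← h1, ← h2, h.integral_form_comm]

/-- The quadratic form `mu` is `(2|U|)⁻¹ p · flux p` with a symmetric flux map, so polarization
returns the map itself: `a(U) p` is the mean of the flux. -/
theorem app_coarse (hS : IsCellFamily a U S) [IsFiniteMeasure (volume.restrict U)]
    (h : IsEllipticOn a U lam Lam) (p : E d) :
    app (coarse a U) p = (volume.real U)⁻¹ • hS.flux p := by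
  have hij : ∀ i j, coarse a U i j = (volume.real U)⁻¹ * inner ℝ (basisVec i)
      (hS.flux (basisVec j)) := by
    intro i j
    simp only [coarse, quadMatrix, Matrix.of_apply, hS.mu_eq_flux, map_add, inner_add_left,
      inner_add_right]
    rw [hS.inner_flux_comm h (basisVec j) (basisVec i), mul_inv]
    ring
  have hp : p = ∑ j, p j • basisVec j := by
    ext k
    simp [basisVec, Finset.sum_apply, Pi.single_apply]
  ext i
  rw [app_apply, PiLp.smul_apply, smul_eq_mul]
  have e : (hS.flux p) i = inner ℝ (basisVec i) (hS.flux p) := by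
    simp [basisVec, EuclideanSpace.inner_single_left]
  rw [e]
  conv_rhs => rw [hp]
  rw [map_sum, inner_sum, Finset.mul_sum]
  refine Finset.sum_congr rfl fun j _ => ?_
  rw [hij, map_smul, inner_smul_right]
  ring

theorem mu_eq_coarse (hS : IsCellFamily a U S) [IsFiniteMeasure (volume.restrict U)]
    (h : IsEllipticOn a U lam Lam) (p : E d) :
    mu a U p = 1 / 2 * form (coarse a U) p p := by
  rw [form, hS.app_coarse h, hS.mu_eq_flux, inner_smul_right, mul_inv]
  ring

end IsCellFamily

/-! ### Ellipticity of coefficient fields in cubes -/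

theorem form_eq_sum (A : Mat d) (x y : E d) : form A x y = ∑ i, ∑ j, x i * (A i j * y j) := by
  simp only [form, PiLp.inner_apply, app_apply]
  refine Finset.sum_congr rfl fun i _ => ?_
  rw [← Finset.mul_sum]
  simp [mul_comm]

theorem form_comm_of_posDef {A : Mat d} (hA : A.PosDef) (x y : E d) :
    form A x y = form A y x := by
  rw [form_eq_sum, form_eq_sum, Finset.sum_comm]
  refine Finset.sum_congr rfl fun i _ => Finset.sum_congr rfl fun j _ => ?_
  have : A j i = A i j := by simpa using hA.isHermitian.apply i j
  rw [this]
  ring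

theorem form_nonneg_of_posDef {A : Mat d} (hA : A.PosDef) (x : E d) : 0 ≤ form A x x := by
  have h := hA.posSemidef.dotProduct_mulVec_nonneg x.ofLp
  rw [form_eq_sum]
  simpa [dotProduct, Matrix.mulVec, Finset.mul_sum] using h

theorem abs_form_le (A : Mat d) (x y : E d) : |form A x y| ≤ opNorm A * (‖x‖ * ‖y‖) := by
  calc |form A x y| ≤ ‖x‖ * ‖app A y‖ := abs_real_inner_le_norm _ _
    _ ≤ ‖x‖ * (opNorm A * ‖y‖) := by gcongr; exact norm_app_le A y
    _ = _ := by ring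

theorem opNorm_nonneg (A : Mat d) : 0 ≤ opNorm A := norm_nonneg _

/-- Combine `|x| ≤ K |A x|`, from the inverse, with `|A x|² ≤ K x · A x`. The cubic power is crude,
but only positivity of the essential infimum is needed. -/
theorem form_lower_of_posDef {A : Mat d} (hA : A.PosDef) {K : ℝ} (hK : 0 < K)
    (h1 : opNorm A ≤ K) (h2 : opNorm A⁻¹ ≤ K) (x : E d) :
    (K ^ 3)⁻¹ * ‖x‖ ^ 2 ≤ form A x x := by
  have he : IsEllipticMat 0 K A := by
    refine ⟨form_comm_of_posDef hA, fun y => ?_, fun y => ?_⟩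
    · simpa using form_nonneg_of_posDef hA y
    · calc form A y y ≤ opNorm A * (‖y‖ * ‖y‖) := (le_abs_self _).trans (abs_form_le A y y)
        _ ≤ K * (‖y‖ * ‖y‖) := by gcongr
        _ = _ := by ring
  have h3 := he.norm_app_sq_le le_rfl hK x
  have h4 : app A⁻¹ (app A x) = x := by
    have : A⁻¹ * A = 1 := Matrix.nonsing_inv_mul A ((Matrix.isUnit_iff_isUnit_det A).1 hA.isUnit)
    rw [app, app, ← mul_apply_eq_comp, ← map_mul, this, map_one]
    rfl
  have h5 : ‖x‖ ≤ K * ‖app A x‖ := by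
    calc ‖x‖ = ‖app A⁻¹ (app A x)‖ := by rw [h4]
      _ ≤ opNorm A⁻¹ * ‖app A x‖ := norm_app_le _ _
      _ ≤ _ := by gcongr
  rw [inv_mul_le_iff₀ (by positivity)]
  calc ‖x‖ ^ 2 ≤ (K * ‖app A x‖) ^ 2 := by gcongr
    _ = K ^ 2 * ‖app A x‖ ^ 2 := by ring
    _ ≤ K ^ 2 * (K * form A x x) := by gcongr
    _ = _ := by ring

theorem nonempty_sphere (hd : 1 ≤ d) : Nonempty (Metric.sphere (0 : E d) 1) :=
  ⟨⟨basisVec ⟨0, hd⟩, by simp [basisVec]⟩⟩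

theorem form_smul_smul (A : Mat d) (c : ℝ) (x : E d) : form A (c • x) (c • x) = c ^ 2 * form A x x := by
  simp only [form, app_smul, inner_smul_left, inner_smul_right]
  simp
  ring

theorem exists_sphere_smul (hd : 1 ≤ d) (x : E d) :
    ∃ ξ : Metric.sphere (0 : E d) 1, x = ‖x‖ • ξ.1 := by
  by_cases hx : x = 0
  · obtain ⟨ξ⟩ := nonempty_sphere hd
    exact ⟨ξ, by simp [hx]⟩
  · have h : ‖x‖ ≠ 0 := norm_ne_zero_iff.2 hx
    exact ⟨⟨‖x‖⁻¹ • x, by simp [norm_smul, h]⟩, by simp [smul_smul, h]⟩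

/-- Local boundedness of `a` and `a⁻¹` gives uniform bounds on the cube. They make the real-valued
suprema, infima and essential bounds genuine rather than default values, and keep the lower one
positive. -/
theorem CoeffField.isEllipticOn (hd : 1 ≤ d) (a : CoeffField d) (z : E d) (n : ℕ) :
    IsEllipticOn a (cube z n) (ellInf a (cube z n)) (ellSup a (cube z n)) := by
  obtain ⟨hmeas, hpd, hbdd⟩ := a.2
  obtain ⟨K', hK'⟩ := hbdd _ (isBounded_cube z n)
  set K := max K' 1 with hKdef
  have hK : 0 < K := lt_of_lt_of_le one_pos (le_max_right _ _)
  have hK1 : ∀ x ∈ cube z n, opNorm (a x) ≤ K := fun x hx =>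
    (le_trans (le_add_of_nonneg_right (opNorm_nonneg _)) (hK' x hx)).trans (le_max_left _ _)
  have hK2 : ∀ x ∈ cube z n, opNorm (a x)⁻¹ ≤ K := fun x hx =>
    (le_trans (le_add_of_nonneg_left (opNorm_nonneg _)) (hK' x hx)).trans (le_max_left _ _)
  have := nonempty_sphere hd
  have hup : ∀ x ∈ cube z n, ∀ ξ : Metric.sphere (0 : E d) 1, form (a x) ξ.1 ξ.1 ≤ K := by
    intro x hx ξ
    have h1 : ‖ξ.1‖ = 1 := by simp
    have h2 := (le_abs_self _).trans (abs_form_le (a x) ξ.1 ξ.1)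
    rw [h1, mul_one, mul_one] at h2
    exact h2.trans (hK1 x hx)
  have hlow : ∀ x ∈ cube z n, ∀ ξ : Metric.sphere (0 : E d) 1,
      (K ^ 3)⁻¹ ≤ form (a x) ξ.1 ξ.1 := by
    intro x hx ξ
    have h1 : ‖ξ.1‖ = 1 := by simp
    have h2 := form_lower_of_posDef (hpd x) hK (hK1 x hx) (hK2 x hx) ξ.1
    rwa [h1, one_pow, mul_one] at h2
  have hba : ∀ x ∈ cube z n, BddAbove (Set.range fun ξ : Metric.sphere (0 : E d) 1 =>
      form (a x) ξ.1 ξ.1) := fun x hx => ⟨K, by rintro _ ⟨ξ, rfl⟩; exact hup x hx ξ⟩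
  have hbb : ∀ x ∈ cube z n, BddBelow (Set.range fun ξ : Metric.sphere (0 : E d) 1 =>
      form (a x) ξ.1 ξ.1) := fun x hx => ⟨(K ^ 3)⁻¹, by rintro _ ⟨ξ, rfl⟩; exact hlow x hx ξ⟩
  have hmem : ∀ᵐ x ∂volume.restrict (cube z n), x ∈ cube z n :=
    ae_restrict_mem (measurableSet_cube z n)
  have hne : (MeasureTheory.ae (volume.restrict (cube z n))).NeBot := by
    rw [MeasureTheory.ae_neBot, Ne, Measure.restrict_eq_zero, volume_cube]
    simp
  have hsup : ∀ᵐ x ∂volume.restrict (cube z n),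
      (⨆ ξ : Metric.sphere (0 : E d) 1, form (a x) ξ.1 ξ.1) ≤ ellSup a (cube z n) := by
    refine ae_le_essSup (isBoundedUnder_of_eventually_le (a := K) ?_)
    filter_upwards [hmem] with x hx using ciSup_le (hup x hx)
  have hinf : ∀ᵐ x ∂volume.restrict (cube z n),
      ellInf a (cube z n) ≤ ⨅ ξ : Metric.sphere (0 : E d) 1, form (a x) ξ.1 ξ.1 := by
    refine ae_essInf_le (isBoundedUnder_of_eventually_ge (a := (K ^ 3)⁻¹) ?_)
    filter_upwards [hmem] with x hx using le_ciInf (hlow x hx)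
  have hinf' : (K ^ 3)⁻¹ ≤ ellInf a (cube z n) := by
    refine le_essInf_of_ae_le _ ?_ ?_
    · filter_upwards [hmem] with x hx using le_ciInf (hlow x hx)
    · refine (isBoundedUnder_of_eventually_le (a := K) ?_).isCoboundedUnder_ge
      filter_upwards [hmem] with x hx
      exact (ciInf_le (hbb x hx) (Classical.arbitrary _)).trans (hup x hx _)
  refine ⟨fun i j => (hmeas i j).restrict, lt_of_lt_of_le (by positivity) hinf', ?_, ?_⟩
  · obtain ⟨x, hx, h1, h2⟩ := (hmem.and (hsup.and hinf)).exists
    exact h2.trans (((ciInf_le (hbb x hx) (Classical.arbitrary _)).trans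
      (le_ciSup (hba x hx) (Classical.arbitrary _))).trans h1)
  · filter_upwards [hmem, hsup, hinf] with x hx h1 h2
    refine ⟨form_comm_of_posDef (hpd x), fun y => ?_, fun y => ?_⟩
    · obtain ⟨ξ, hξ⟩ := exists_sphere_smul hd y
      rw [hξ, form_smul_smul, ← hξ, mul_comm]
      gcongr
      exact h2.trans (ciInf_le (hbb x hx) ξ)
    · obtain ⟨ξ, hξ⟩ := exists_sphere_smul hd y
      rw [hξ, form_smul_smul, ← hξ, mul_comm (ellSup _ _)]
      gcongr
      exact (le_ciSup (hba x hx) ξ).trans h1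

/-! ### Comparison of the minimizers at different scales -/

theorem real_cube_pos (z : E d) (n : ℕ) : 0 < volume.real (cube z n) := by
  rw [real_cube]; positivity

theorem abs_form_sub_le (A B : Mat d) {p : E d} (hp : ‖p‖ ≤ 1) :
    |form A p p - form B p p| ≤ opNorm (A - B) := by
  have e : form A p p - form B p p = form (A - B) p p := by
    simp only [form, app_sub_left, inner_sub_right]
  rw [e]
  calc _ ≤ opNorm (A - B) * (‖p‖ * ‖p‖) := abs_form_le _ _ _
    _ ≤ opNorm (A - B) * (1 * 1) := by
        gcongr
        exact opNorm_nonneg _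
    _ = _ := by ring

theorem opNorm_sub_le (A B : Mat d) : opNorm (A - B) ≤ opNorm A + opNorm B := by
  rw [opNorm, map_sub]
  exact norm_sub_le _ _

theorem IsEllipticOn.integral_form_sub {a : E d → Mat d} {U : Set (E d)} {lam Lam : ℝ}
    (h : IsEllipticOn a U lam Lam) {F G : E d → E d} (hF : MemLp F 2 (volume.restrict U))
    (hG : MemLp G 2 (volume.restrict U)) :
    ∫ x in U, form (a x) (F x - G x) (F x - G x) =
      (∫ x in U, form (a x) (F x) (F x)) - 2 * (∫ x in U, form (a x) (G x) (F x)) +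
        ∫ x in U, form (a x) (G x) (G x) := by
  have e : ∀ x, form (a x) (F x - G x) (F x - G x) =
      form (a x) (F x) (F x) - form (a x) (F x) (G x) - form (a x) (G x) (F x) +
        form (a x) (G x) (G x) := fun x => by
    simp only [form, app_sub, inner_sub_left, inner_sub_right]
    ring
  simp only [e]
  have i1 := h.integrable_form hF hF
  have i2 := h.integrable_form hF hG
  have i3 := h.integrable_form hG hF
  have i4 := h.integrable_form hG hG
  have j1 : Integrable (fun x => form (a x) (F x) (F x) - form (a x) (F x) (G x))
    (volume.restrict U) := i1.sub i2
  have j2 : Integrable (fun x => form (a x) (F x) (F x) - form (a x) (F x) (G x) -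
    form (a x) (G x) (F x)) (volume.restrict U) := j1.sub i3
  rw [integral_add j2 i4, integral_sub j1 i3, integral_sub i1 i2, h.integral_form_comm F G]
  ring

/-- The mean distance of the coarse-grained matrices at scale `3^m` from `abar`. -/
def coarseDist (a : E d → Mat d) (abar : Mat d) (n m : ℕ) : ℝ :=
  ((3 : ℝ) ^ ((n - m) * d))⁻¹ *
    ∑ k ∈ subcubes d n m, opNorm (coarse a (cube (latticePt m k) m) - abar)

theorem coarseDist_nonneg (a : E d → Mat d) (abar : Mat d) (n m : ℕ) :
    0 ≤ coarseDist a abar n m :=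
  mul_nonneg (by positivity) (Finset.sum_nonneg fun _ _ => opNorm_nonneg _)

theorem sum_opNorm_eq (a : E d → Mat d) (abar : Mat d) {n m : ℕ} (h : m ≤ n) :
    ∑ k ∈ subcubes d n m, ((3 : ℝ) ^ m) ^ d * opNorm (coarse a (cube (latticePt m k) m) - abar) =
      (3 ^ n) ^ d * coarseDist a abar n m := by
  rw [coarseDist, ← Finset.mul_sum, cube_pow_eq h]
  field_simp

theorem coarseDist_self (a : E d → Mat d) (abar : Mat d) (n : ℕ) :
    coarseDist a abar n n = opNorm (coarse a (cube 0 n) - abar) := by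
  rw [coarseDist, subcubes_self, Finset.sum_singleton, latticePt_zero]
  simp

section

variable {a : E d → Mat d} {lam Lam : ℝ} {n m : ℕ} {S : E d → E d → E d}
  {R : (Fin d → ℤ) → E d → E d → E d} {p : E d}

theorem IsCellFamily.integral_form_self {z : E d} (hS : IsCellFamily a (cube z n) S)
    (h : IsEllipticOn a (cube z n) lam Lam) (p : E d) :
    ∫ x in cube z n, form (a x) (S p x) (S p x) =
      (3 ^ n) ^ d * form (coarse a (cube z n)) p p := by
  have h1 := hS.mu_eq_coarse h p
  rw [hS.mu_eq, energy_eq, real_cube] at h1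
  have hV : (0 : ℝ) < (3 ^ n) ^ d := by positivity
  field_simp at h1
  linarith

/-- Since `∫ p · a S p = ∫ S p · a S p`, the two left-hand sides add up to `∫ p · a p`, and both are
nonnegative. -/
theorem IsCellFamily.integral_form_self_le {z : E d} (hS : IsCellFamily a (cube z n) S)
    (h : IsEllipticOn a (cube z n) lam Lam) (p : E d) :
    ∫ x in cube z n, form (a x) (S p x - p) (S p x - p) ≤ Lam * ((3 ^ n) ^ d * ‖p‖ ^ 2) ∧
    ∫ x in cube z n, form (a x) (S p x) (S p x) ≤ Lam * ((3 ^ n) ^ d * ‖p‖ ^ 2) := by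
  have hp : MemLp (fun _ => p) 2 (volume.restrict (cube z n)) := memLp_const p
  have h1 := h.integral_form_sub (hS.memLp p) hp
  have h2 := h.upper_integral hp
  rw [integral_const, restrict_univ_cube, smul_eq_mul] at h2
  have h3 := hS.integral_form_eq p p
  have h4 := h.lower_integral (hS.memLp p)
  have h5 := h.lower_integral ((hS.memLp p).sub hp)
  have h6 : 0 ≤ ∫ x in cube z n, form (a x) (S p x - p) (S p x - p) :=
    le_trans (mul_nonneg h.pos.le (integral_nonneg fun _ => by positivity)) h5
  have h7 : 0 ≤ ∫ x in cube z n, form (a x) (S p x) (S p x) :=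
    le_trans (mul_nonneg h.pos.le (integral_nonneg fun _ => by positivity)) h4
  constructor <;> linarith

theorem IsCellFamily.setAverage_app {z : E d} (hS : IsCellFamily a (cube z n) S)
    (h : IsEllipticOn a (cube z n) lam Lam) (p : E d) :
    ⨍ x in cube z n, app (a x) (S p x) = app (coarse a (cube z n)) p := by
  rw [hS.app_coarse h, MeasureTheory.setAverage_eq]
  rfl

theorem IsCellFamily.opNorm_coarse_le {z : E d} (hS : IsCellFamily a (cube z n) S)
    (h : IsEllipticOn a (cube z n) lam Lam) : opNorm (coarse a (cube z n)) ≤ Lam := by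
  have hL : 0 < Lam := h.pos.trans_le h.le
  have hV : (0 : ℝ) < (3 ^ n) ^ d := by positivity
  refine ContinuousLinearMap.opNorm_le_bound _ hL.le fun q => ?_
  refine le_of_sq_le_sq ?_ (by positivity)
  change ‖app (coarse a (cube z n)) q‖ ^ 2 ≤ _
  rw [← hS.setAverage_app h]
  refine (norm_setAverage_sq_le (hS.solenoidal q).1).trans ?_
  rw [setAverage_cube, smul_eq_mul, inv_mul_le_iff₀ hV]
  calc _ ≤ Lam * ∫ x in cube z n, form (a x) (S q x) (S q x) :=
        h.integral_norm_app_sq_le (hS.memLp q)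
    _ ≤ Lam * (Lam * ((3 ^ n) ^ d * ‖q‖ ^ 2)) := by
        gcongr
        exact (hS.integral_form_self_le h q).2
    _ = _ := by ring

/-- The energy of the difference between the minimizer in `□_n` and the minimizers in the
subcubes of size `3^m` is controlled by the distance of the coarse-grained matrices. -/
theorem sum_integral_form_sub_le (hmn : m ≤ n) (h : IsEllipticOn a (cube 0 n) lam Lam)
    (hS : IsCellFamily a (cube 0 n) S)
    (hR : ∀ k ∈ subcubes d n m, IsCellFamily a (cube (latticePt m k) m) (R k))
    (abar : Mat d) (hp : ‖p‖ ≤ 1) :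
    ∑ k ∈ subcubes d n m, ∫ x in cube (latticePt m k) m,
        form (a x) (S p x - R k p x) (S p x - R k p x) ≤
      (3 ^ n) ^ d * (coarseDist a abar n m + coarseDist a abar n n) := by
  have hV : ∀ n : ℕ, (0 : ℝ) < (3 ^ n) ^ d := fun n => by positivity
  have hsub := fun k (hk : k ∈ subcubes d n m) => latticePt_subcube_subset hmn hk
  have hi1 := h.integrable_form (hS.memLp p) (hS.memLp p)
  have hi2 := h.integrable_form (memLp_const p) (hS.memLp p)
  have e1 : ∀ k ∈ subcubes d n m, ∫ x in cube (latticePt m k) m,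
      form (a x) (S p x - R k p x) (S p x - R k p x) =
      (∫ x in cube (latticePt m k) m, form (a x) (S p x) (S p x)) -
        2 * (∫ x in cube (latticePt m k) m, form (a x) p (S p x)) +
          (3 ^ m) ^ d * form (coarse a (cube (latticePt m k) m)) p p := by
    intro k hk
    have hSk := (hS.memLp p).mono_measure (Measure.restrict_mono_set volume (hsub k hk))
    -- The cross term: the flux of the large minimizer is solenoidal in the subcube, so `R k p` may
    -- be replaced by `p`.
    have h2 := (hR k hk).integral_inner_eq ((hS.solenoidal p).mono (hsub k hk)) p
    rw [(h.mono (hsub k hk)).integral_form_sub hSk ((hR k hk).memLp p),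
      (hR k hk).integral_form_self (h.mono (hsub k hk))]
    simp only [real_inner_comm] at h2
    simp only [form] at h2 ⊢
    rw [h2]
  rw [Finset.sum_congr rfl e1, Finset.sum_add_distrib, Finset.sum_sub_distrib, ← Finset.mul_sum,
    ← integral_cube_zero_eq_sum hmn hi1, ← integral_cube_zero_eq_sum hmn hi2,
    ← hS.integral_form_eq, hS.integral_form_self h]
  have e2 : ∑ k ∈ subcubes d n m, ((3 : ℝ) ^ m) ^ d * form (coarse a (cube (latticePt m k) m)) p p ≤
      (3 ^ n) ^ d * coarseDist a abar n m + (3 ^ n) ^ d * form abar p p := by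
    have e3 : ((3 : ℝ) ^ n) ^ d * form abar p p =
        ∑ k ∈ subcubes d n m, ((3 : ℝ) ^ m) ^ d * form abar p p := by
      rw [Finset.sum_const, nsmul_eq_mul, card_subcubes hmn, cube_pow_eq hmn]
      ring
    rw [← sum_opNorm_eq a abar hmn, e3, ← Finset.sum_add_distrib]
    refine Finset.sum_le_sum fun k _ => ?_
    rw [← mul_add]
    gcongr
    have := (le_abs_self _).trans (abs_form_sub_le (coarse a (cube (latticePt m k) m)) abar hp)
    linarith
  -- After summation the terms in `S` alone collapse to `-|□_n| p · a(□_n) p`; comparing with `abar`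
  -- gives the contribution of scale `n`.
  have e4 : (3 ^ n) ^ d * (form abar p p - form (coarse a (cube 0 n)) p p) ≤
      (3 ^ n) ^ d * coarseDist a abar n n := by
    gcongr
    rw [coarseDist_self]
    have := (neg_abs_le _).trans' (neg_le_neg (abs_form_sub_le (coarse a (cube 0 n)) abar hp))
    linarith
  linarith

theorem meanNorm_le_sqrt {F : E d → E d} {Y : ℝ} (hmn : m ≤ n)
    (h : ∑ k ∈ subcubes d n m, (3 ^ m) ^ d * ‖⨍ x in cube (latticePt m k) m, F x‖ ^ 2 ≤
      (3 ^ n) ^ d * Y) : meanNorm F n m ≤ Real.sqrt Y := by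
  have hV : (0 : ℝ) < (3 ^ n) ^ d := by positivity
  have h1 := Real.sqrt_le_sqrt h
  rw [sqrt_sum_mean_sq hmn, Real.sqrt_mul hV.le] at h1
  exact le_of_mul_le_mul_left h1 (Real.sqrt_pos.2 hV)

/-- The local minimizers have mean gradient `p`, so on each subcube `S p - p` has the same mean as
`S p - R k p`. Jensen and the lower ellipticity bound reduce this to the energy estimate. -/
theorem meanNorm_gradient_le (hmn : m ≤ n) (h : IsEllipticOn a (cube 0 n) lam Lam)
    (hS : IsCellFamily a (cube 0 n) S)
    (abar : Mat d) (hp : ‖p‖ ≤ 1) :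
    meanNorm (fun x => S p x - p) n m ≤
      Real.sqrt (1 / lam * (coarseDist a abar n m + coarseDist a abar n n)) := by
  have hsub := fun k (hk : k ∈ subcubes d n m) => latticePt_subcube_subset hmn hk
  have hex : ∀ k, ∃ R, k ∈ subcubes d n m → IsCellFamily a (cube (latticePt m k) m) R := by
    intro k
    by_cases hk : k ∈ subcubes d n m
    · obtain ⟨R, hR⟩ := (h.mono (hsub k hk)).exists_isCellFamily (real_cube_pos _ _)
      exact ⟨R, fun _ => hR⟩
    · exact ⟨fun _ _ => 0, fun h => absurd h hk⟩
  choose R hR using hex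
  have hlam := h.pos
  have hVm : (0 : ℝ) < (3 ^ m) ^ d := by positivity
  refine meanNorm_le_sqrt hmn ?_
  have key := sum_integral_form_sub_le hmn h hS (fun k hk => hR k hk) abar hp
  calc _ ≤ ∑ k ∈ subcubes d n m, 1 / lam * ∫ x in cube (latticePt m k) m,
        form (a x) (S p x - R k p x) (S p x - R k p x) := by
        refine Finset.sum_le_sum fun k hk => ?_
        have hSk := (hS.memLp p).mono_measure (Measure.restrict_mono_set volume (hsub k hk))
        have hD : MemLp (fun x => S p x - R k p x) 2
          (volume.restrict (cube (latticePt m k) m)) := hSk.sub ((hR k hk).memLp p)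
        have e : ⨍ x in cube (latticePt m k) m, (S p x - p) =
            ⨍ x in cube (latticePt m k) m, (S p x - R k p x) := by
          rw [setAverage_cube, setAverage_cube, integral_sub (hSk.integrable (by norm_num))
            (integrable_const _), integral_sub (hSk.integrable (by norm_num))
            (((hR k hk).memLp p).integrable (by norm_num)), (hR k hk).integral_eq, integral_const,
            restrict_univ_cube, real_cube]
        have h1 := norm_setAverage_sq_le hD
        rw [setAverage_cube (f := fun x => ‖S p x - R k p x‖ ^ 2), smul_eq_mul,
          ← div_eq_inv_mul, le_div_iff₀' hVm] at h1
        have h2 := (h.mono (hsub k hk)).lower_integral hD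
        rw [e, one_div, ← div_eq_inv_mul, le_div_iff₀' hlam]
        exact (mul_le_mul_of_nonneg_left h1 hlam.le).trans h2
    _ ≤ 1 / lam * ((3 ^ n) ^ d * (coarseDist a abar n m + coarseDist a abar n n)) := by
        rw [← Finset.mul_sum]
        gcongr
    _ = _ := by ring

/-- On a subcube the mean of the flux error is the mean of `a (S p - R k p)` plus `(a(Q) - abar) p`,
because `a(Q) p` is the mean flux of the local minimizer. -/
theorem meanNorm_flux_le (hmn : m ≤ n) (h : IsEllipticOn a (cube 0 n) lam Lam)
    (hS : IsCellFamily a (cube 0 n) S)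
    (abar : Mat d) (hp : ‖p‖ ≤ 1) :
    meanNorm (fun x => app (a x) (S p x) - app abar p) n m ≤
      Real.sqrt (4 * (Lam + opNorm abar) * (coarseDist a abar n m + coarseDist a abar n n)) := by
  have hsub := fun k (hk : k ∈ subcubes d n m) => latticePt_subcube_subset hmn hk
  have hex : ∀ k, ∃ R, k ∈ subcubes d n m → IsCellFamily a (cube (latticePt m k) m) R := by
    intro k
    by_cases hk : k ∈ subcubes d n m
    · obtain ⟨R, hR⟩ := (h.mono (hsub k hk)).exists_isCellFamily (real_cube_pos _ _)
      exact ⟨R, fun _ => hR⟩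
    · exact ⟨fun _ _ => 0, fun h => absurd h hk⟩
  choose R hR using hex
  have hL : 0 < Lam := h.pos.trans_le h.le
  have hVm : (0 : ℝ) < (3 ^ m) ^ d := by positivity
  have hVn : (0 : ℝ) < (3 ^ n) ^ d := by positivity
  have hb := opNorm_nonneg abar
  refine meanNorm_le_sqrt hmn ?_
  have key := sum_integral_form_sub_le hmn h hS (fun k hk => hR k hk) abar hp
  have hA := coarseDist_nonneg a abar n m
  have hA' := coarseDist_nonneg a abar n n
  calc _ ≤ ∑ k ∈ subcubes d n m, (2 * Lam * (∫ x in cube (latticePt m k) m,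
        form (a x) (S p x - R k p x) (S p x - R k p x)) + 2 * (Lam + opNorm abar) *
          ((3 ^ m) ^ d * opNorm (coarse a (cube (latticePt m k) m) - abar))) := by
        refine Finset.sum_le_sum fun k hk => ?_
        have hk' := h.mono (hsub k hk)
        have hSk := (hS.memLp p).mono_measure (Measure.restrict_mono_set volume (hsub k hk))
        have hD : MemLp (fun x => S p x - R k p x) 2
          (volume.restrict (cube (latticePt m k) m)) := hSk.sub ((hR k hk).memLp p)
        have hi1 := (hk'.memLp_app hSk).integrable (q := 2) (by norm_num)
        have hi2 := ((hR k hk).solenoidal p).1.integrable (by norm_num)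
        set c := coarse a (cube (latticePt m k) m) with hc
        have e : ⨍ x in cube (latticePt m k) m, (app (a x) (S p x) - app abar p) =
            (⨍ x in cube (latticePt m k) m, app (a x) (S p x - R k p x)) + app (c - abar) p := by
          rw [app_sub_left, ← (hR k hk).setAverage_app hk']
          simp only [app_sub]
          rw [setAverage_cube, setAverage_cube, setAverage_cube, integral_sub hi1
            (integrable_const _), integral_sub hi1 hi2, integral_const, restrict_univ_cube,
            smul_sub, smul_sub, inv_smul_smul₀ hVm.ne']
          abel
        have h1 := norm_setAverage_sq_le (hk'.memLp_app hD)
        rw [setAverage_cube (f := fun x => ‖app (a x) (S p x - R k p x)‖ ^ 2), smul_eq_mul,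
          ← div_eq_inv_mul, le_div_iff₀' hVm] at h1
        have h2 := h1.trans (hk'.integral_norm_app_sq_le hD)
        have h3 : ‖app (c - abar) p‖ ≤ opNorm (c - abar) := by
          calc _ ≤ opNorm (c - abar) * ‖p‖ := norm_app_le _ _
            _ ≤ opNorm (c - abar) * 1 := by
              gcongr
              exact opNorm_nonneg _
            _ = _ := mul_one _
        have h4 : opNorm (c - abar) ≤ Lam + opNorm abar :=
          (opNorm_sub_le _ _).trans (by gcongr; exact (hR k hk).opNorm_coarse_le hk')
        -- One factor of the squared distance is bounded crudely, so that the distance enters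
        -- linearly as in `coarseDist`.
        have h5 : ‖app (c - abar) p‖ ^ 2 ≤ (Lam + opNorm abar) * opNorm (c - abar) := by
          calc _ ≤ opNorm (c - abar) ^ 2 := by gcongr
            _ = opNorm (c - abar) * opNorm (c - abar) := sq _
            _ ≤ _ := mul_le_mul_of_nonneg_right h4 (opNorm_nonneg _)
        rw [e]
        set X := ⨍ x in cube (latticePt m k) m, app (a x) (S p x - R k p x)
        have h6 : ‖X + app (c - abar) p‖ ^ 2 ≤ 2 * (‖X‖ ^ 2 + ‖app (c - abar) p‖ ^ 2) :=
          (pow_le_pow_left₀ (norm_nonneg _) (norm_add_le _ _) 2).trans (add_sq_le)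
        calc _ ≤ (3 ^ m) ^ d * (2 * (‖X‖ ^ 2 + ‖app (c - abar) p‖ ^ 2)) :=
              mul_le_mul_of_nonneg_left h6 hVm.le
          _ = 2 * ((3 ^ m) ^ d * ‖X‖ ^ 2) + 2 * ((3 ^ m) ^ d * ‖app (c - abar) p‖ ^ 2) := by ring
          _ ≤ 2 * (Lam * ∫ x in cube (latticePt m k) m,
                form (a x) (S p x - R k p x) (S p x - R k p x)) +
              2 * ((3 ^ m) ^ d * ((Lam + opNorm abar) * opNorm (c - abar))) := by
              gcongr
          _ = _ := by ring
    _ ≤ 2 * Lam * ((3 ^ n) ^ d * (coarseDist a abar n m + coarseDist a abar n n)) +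
        2 * (Lam + opNorm abar) * ((3 ^ n) ^ d * coarseDist a abar n m) := by
        rw [Finset.sum_add_distrib, ← Finset.mul_sum, ← Finset.mul_sum, sum_opNorm_eq a abar hmn]
        gcongr
    _ = (3 ^ n) ^ d * (2 * Lam * (coarseDist a abar n m + coarseDist a abar n n) +
        2 * (Lam + opNorm abar) * coarseDist a abar n m) := by ring
    _ ≤ _ := by
        gcongr
        nlinarith [mul_nonneg hL.le hA, mul_nonneg hL.le hA', mul_nonneg hb hA, mul_nonneg hb hA']

end

/-! ### Conclusion -/

theorem normHhat_congr {U : Set (E d)} {F G : E d → E d} (h : F =ᵐ[volume.restrict U] G) :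
    normHhat U F = normHhat U G := by
  have e : ∀ Ψ : E d → E d, ⨍ x in U, inner ℝ (F x) (Ψ x) = ⨍ x in U, inner ℝ (G x) (Ψ x) := by
    intro Ψ
    rw [setAverage_eq, setAverage_eq]
    congr 1
    refine integral_congr_ae ?_
    filter_upwards [h] with x hx
    rw [hx]
  simp only [normHhat, e]

theorem defect_eq (a : E d → Mat d) (abar : Mat d) (n : ℕ) :
    defect a abar n = (∑ m ∈ Finset.range (n + 1),
      ((3 : ℝ) ^ (n - m))⁻¹ * Real.sqrt (coarseDist a abar n m)) ^ 2 := rfl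

theorem sum_three_pow_le (n : ℕ) : ∑ m ∈ Finset.range (n + 1), (3 : ℝ) ^ m ≤ 3 / 2 * 3 ^ n := by
  rw [geom_sum_eq (by norm_num), pow_succ]
  linarith

/-- With `T` the square root of `defect`, the scale `m` parts sum to `3^n T`. The scale `n` parts
contribute at most `(3/2) 3^n T`, since `sqrt (coarseDist n n)` is the last summand of `T`. Hence `1
+ 3/2 = 5/2`. -/
theorem sum_meanNorm_le {F : E d → E d} {a : E d → Mat d} {abar : Mat d} {n : ℕ} {Y : ℝ}
    (hY : 0 ≤ Y)
    (hF : ∀ m ≤ n, meanNorm F n m ≤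
      Real.sqrt (Y * (coarseDist a abar n m + coarseDist a abar n n))) :
    ∑ m ∈ Finset.range (n + 1), 3 ^ m * meanNorm F n m ≤
      5 / 2 * (3 ^ n * Real.sqrt (Y * defect a abar n)) := by
  set A := fun m => Real.sqrt (coarseDist a abar n m) with hA
  set T := ∑ m ∈ Finset.range (n + 1), ((3 : ℝ) ^ (n - m))⁻¹ * A m with hT
  have hA0 : ∀ m, 0 ≤ A m := fun m => Real.sqrt_nonneg _
  have hT0 : 0 ≤ T := Finset.sum_nonneg fun m _ => mul_nonneg (by positivity) (hA0 m)
  have hAT : A n ≤ T := by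
    have := Finset.single_le_sum (f := fun m => ((3 : ℝ) ^ (n - m))⁻¹ * A m)
      (fun m _ => mul_nonneg (by positivity) (hA0 m)) (Finset.self_mem_range_succ n)
    simpa using this
  have hs : ∑ m ∈ Finset.range (n + 1), 3 ^ m * A m = 3 ^ n * T := by
    rw [hT, Finset.mul_sum]
    refine Finset.sum_congr rfl fun m hm => ?_
    obtain ⟨j, rfl⟩ := Nat.exists_eq_add_of_le (Nat.lt_succ_iff.1 (Finset.mem_range.1 hm))
    rw [Nat.add_sub_cancel_left, pow_add]
    field_simp
  have hdef : Real.sqrt (Y * defect a abar n) = Real.sqrt Y * T := by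
    rw [defect_eq, Real.sqrt_mul hY, Real.sqrt_sq hT0]
  have hm : ∀ m ∈ Finset.range (n + 1), 3 ^ m * meanNorm F n m ≤
      Real.sqrt Y * (3 ^ m * A m + 3 ^ m * A n) := by
    intro m hm
    have h1 := hF m (Nat.lt_succ_iff.1 (Finset.mem_range.1 hm))
    rw [Real.sqrt_mul hY] at h1
    have h2 : Real.sqrt (coarseDist a abar n m + coarseDist a abar n n) ≤ A m + A n := by
      refine Real.sqrt_le_iff.2 ⟨add_nonneg (hA0 m) (hA0 n), ?_⟩
      have e1 : A m ^ 2 = _ := Real.sq_sqrt (coarseDist_nonneg a abar n m)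
      have e2 : A n ^ 2 = _ := Real.sq_sqrt (coarseDist_nonneg a abar n n)
      rw [add_sq, e1, e2]
      linarith [mul_nonneg (hA0 m) (hA0 n)]
    calc _ ≤ 3 ^ m * (Real.sqrt Y * (A m + A n)) := by
          gcongr
          exact h1.trans (mul_le_mul_of_nonneg_left h2 (Real.sqrt_nonneg _))
      _ = _ := by ring
  calc _ ≤ ∑ m ∈ Finset.range (n + 1), Real.sqrt Y * (3 ^ m * A m + 3 ^ m * A n) :=
        Finset.sum_le_sum hm
    _ = Real.sqrt Y * (3 ^ n * T + (∑ m ∈ Finset.range (n + 1), 3 ^ m) * A n) := by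
        rw [← Finset.mul_sum, Finset.sum_add_distrib, hs, Finset.sum_mul]
    _ ≤ Real.sqrt Y * (3 ^ n * T + (3 / 2 * 3 ^ n) * T) := by
        gcongr
        exact sum_three_pow_le n
    _ = _ := by rw [hdef]; ring

/-- Here `X` bounds the mean square of `F` and `Y` is the factor in front of the coarse-grained
distances. Squaring gives the constants `18` and `9 · 2 · 25/4 = 112.5`, both at most `113`. -/
theorem normHhat_sq_le (hd : 1 ≤ d) {F : E d → E d} {a : E d → Mat d} {abar : Mat d} {n : ℕ}
    {X Y : ℝ} (hX : 0 ≤ X) (hY : 0 ≤ Y) (hF : MemLp F 2 (volume.restrict (cube 0 n)))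
    (hFX : ∫ x in cube 0 n, ‖F x‖ ^ 2 ≤ (3 ^ n) ^ d * X)
    (hFY : ∀ m ≤ n, meanNorm F n m ≤
      Real.sqrt (Y * (coarseDist a abar n m + coarseDist a abar n n))) :
    normHhat (cube 0 n) F ^ 2 ≤
      ENNReal.ofReal (113 * poincareConst d * (X + 3 ^ (2 * n) * Y * defect a abar n)) := by
  have hV : (0 : ℝ) < (3 ^ n) ^ d := by positivity
  have hcp : 0 ≤ poincareConst d := by unfold poincareConst; positivity
  have hdef : 0 ≤ defect a abar n := sq_nonneg _
  have hXle : normL2 (cube 0 n) (fun x => ‖F x‖) ≤ Real.sqrt X := by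
    rw [normL2, setAverage_cube, smul_eq_mul]
    refine Real.sqrt_le_sqrt ?_
    rwa [inv_mul_le_iff₀ hV]
  have hYle := sum_meanNorm_le hY hFY
  set c := Real.sqrt (poincareConst d) with hc
  set D := Real.sqrt (Y * defect a abar n) with hD
  have hc0 : 0 ≤ c := Real.sqrt_nonneg _
  calc normHhat (cube 0 n) F ^ 2 ≤
        ENNReal.ofReal (3 * c * (Real.sqrt X + 5 / 2 * (3 ^ n * D))) ^ 2 := by
        gcongr
        refine (normHhat_le hd hF).trans (ENNReal.ofReal_le_ofReal ?_)
        gcongr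
    _ = ENNReal.ofReal ((3 * c * (Real.sqrt X + 5 / 2 * (3 ^ n * D))) ^ 2) :=
        (ENNReal.ofReal_pow (mul_nonneg (by positivity)
          (add_nonneg (Real.sqrt_nonneg _) (by positivity))) 2).symm
    _ ≤ _ := by
        refine ENNReal.ofReal_le_ofReal ?_
        have h1 : Real.sqrt X ^ 2 = X := Real.sq_sqrt hX
        have h2 : D ^ 2 = Y * defect a abar n := Real.sq_sqrt (mul_nonneg hY hdef)
        have h3 : c ^ 2 = poincareConst d := Real.sq_sqrt hcp
        have h4 : (Real.sqrt X + 5 / 2 * (3 ^ n * D)) ^ 2 ≤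
            2 * (Real.sqrt X ^ 2 + (5 / 2 * (3 ^ n * D)) ^ 2) := add_sq_le
        have h5 : (5 / 2 * (3 ^ n * D)) ^ 2 = 25 / 4 * (3 ^ (2 * n) * Y * defect a abar n) := by
          rw [pow_mul', mul_pow, mul_pow, h2]
          ring
        rw [h1, h5] at h4
        have h6 : 0 ≤ 3 ^ (2 * n) * Y * defect a abar n :=
          mul_nonneg (mul_nonneg (by positivity) hY) hdef
        calc _ = 9 * poincareConst d * (Real.sqrt X + 5 / 2 * (3 ^ n * D)) ^ 2 := by
              rw [← h3]; ring
          _ ≤ 9 * poincareConst d *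
              (2 * (X + 25 / 4 * (3 ^ (2 * n) * Y * defect a abar n))) := by gcongr
          _ = poincareConst d * (18 * X + 225 / 2 * (3 ^ (2 * n) * Y * defect a abar n)) := by
              ring
          _ ≤ poincareConst d * (113 * X + 113 * (3 ^ (2 * n) * Y * defect a abar n)) := by
              gcongr <;> norm_num
          _ = _ := by ring

section

variable {a : E d → Mat d} {lam Lam : ℝ} {n : ℕ} {S : E d → E d → E d} {p : E d}

theorem normHhat_gradient_sq_le (hd : 1 ≤ d) (h : IsEllipticOn a (cube 0 n) lam Lam)
    (hS : IsCellFamily a (cube 0 n) S) (abar : Mat d) (hp : ‖p‖ ≤ 1) :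
    normHhat (cube 0 n) (fun x => S p x - p) ^ 2 ≤ ENNReal.ofReal
      (113 * poincareConst d * (Lam / lam + 3 ^ (2 * n) * (1 / lam) * defect a abar n)) := by
  have hlam := h.pos
  have hL : 0 < Lam := h.pos.trans_le h.le
  have hF : MemLp (fun x => S p x - p) 2 (volume.restrict (cube 0 n)) :=
    (hS.memLp p).sub (memLp_const p)
  refine normHhat_sq_le hd (by positivity) (by positivity) hF ?_
    fun m hm => meanNorm_gradient_le hm h hS abar hp
  have h1 := (h.lower_integral hF).trans (hS.integral_form_self_le h p).1
  rw [← le_div_iff₀' hlam] at h1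
  refine h1.trans ?_
  rw [mul_div_assoc', div_le_div_iff_of_pos_right hlam, mul_comm Lam]
  gcongr
  exact mul_le_of_le_one_right (by positivity) (pow_le_one₀ (norm_nonneg _) hp)

theorem normHhat_flux_sq_le (hd : 1 ≤ d) (h : IsEllipticOn a (cube 0 n) lam Lam)
    (hS : IsCellFamily a (cube 0 n) S) (abar : Mat d) (hp : ‖p‖ ≤ 1) :
    normHhat (cube 0 n) (fun x => app (a x) (S p x) - app abar p) ^ 2 ≤ ENNReal.ofReal
      (113 * poincareConst d * (2 * (Lam ^ 2 + opNorm abar ^ 2) +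
        3 ^ (2 * n) * (4 * (Lam + opNorm abar)) * defect a abar n)) := by
  have hL : 0 < Lam := h.pos.trans_le h.le
  have hb := opNorm_nonneg abar
  have hV : (0 : ℝ) < (3 ^ n) ^ d := by positivity
  have hF : MemLp (fun x => app (a x) (S p x) - app abar p) 2 (volume.restrict (cube 0 n)) :=
    (hS.solenoidal p).1.sub (memLp_const _)
  refine normHhat_sq_le hd (by positivity) (by positivity) hF ?_
    fun m hm => meanNorm_flux_le hm h hS abar hp
  have hp2 : ‖p‖ ^ 2 ≤ 1 := pow_le_one₀ (norm_nonneg _) hp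
  have hbp : ‖app abar p‖ ≤ opNorm abar :=
    (norm_app_le _ _).trans (mul_le_of_le_one_right hb hp)
  have h1 := h.integral_norm_app_sq_le (hS.memLp p)
  have h2 := (hS.integral_form_self_le h p).2
  have h3 : ∫ x in cube 0 n, ‖app (a x) (S p x) - app abar p‖ ^ 2 ≤
      ∫ x in cube 0 n, 2 * (‖app (a x) (S p x)‖ ^ 2 + ‖app abar p‖ ^ 2) := by
    refine integral_mono (integrable_norm_sq_of_memLp hF)
      (((integrable_norm_sq_of_memLp (hS.solenoidal p).1).add (integrable_const _)).const_mul _)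
      fun x => ?_
    exact (pow_le_pow_left₀ (norm_nonneg _) (norm_sub_le _ _) 2).trans add_sq_le
  rw [integral_const_mul, integral_add (integrable_norm_sq_of_memLp (hS.solenoidal p).1)
    (integrable_const _), integral_const, restrict_univ_cube, smul_eq_mul] at h3
  refine h3.trans ?_
  calc _ ≤ 2 * (Lam * (Lam * ((3 ^ n) ^ d * 1)) + (3 ^ n) ^ d * opNorm abar ^ 2) := by
        gcongr
        exact h1.trans (mul_le_mul_of_nonneg_left (h2.trans (by gcongr)) hL.le)
    _ = _ := by ring

end

end

end StochHom

/-! ### The proposition -/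

open StochHom
theorem proposition3p1 (d : ℕ) (hd : 1 ≤ d) :
    ∃ C : ℝ, 0 < C ∧
      ∀ (r : ℝ) (_ : 0 < r) (_ : r < 1)
        (P : Measure (CoeffField d)) (_ : IsProbabilityMeasure P)
        (_ : IsStationary P) (_ : IsMixing r P)
        (abar : Mat d) (_ : IsHomogenized P abar)
        (a : CoeffField d) (n : ℕ) (p : E d) (_ : ‖p‖ < 1)
        (v : E d → ℝ) (Dv : E d → E d) (_ : IsMinimizer a (cube 0 n) p v Dv),
        normHhat (cube 0 n) (fun x => Dv x - p) ^ 2 ≤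
          ENNReal.ofReal
            (C * (ellSup a (cube 0 n) / ellInf a (cube 0 n)) +
              C * 3 ^ (2 * n) * (1 / ellInf a (cube 0 n)) * defect a abar n) ∧
        normHhat (cube 0 n) (fun x => app (a x) (Dv x) - app abar p) ^ 2 ≤
          ENNReal.ofReal
            (C * (ellSup a (cube 0 n) ^ 3 / ellInf a (cube 0 n) + opNorm abar ^ 2) +
              C * 3 ^ (2 * n) *
                (ellSup a (cube 0 n) ^ 2 / ellInf a (cube 0 n) + opNorm abar) *
                defect a abar n) := by
  have hd' : (0 : ℝ) < d := by exact_mod_cast hd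
  have hcp : 0 < poincareConst d := by unfold poincareConst; positivity
  -- `452 = 4 · 113`, the factor `4` coming from the flux estimate.
  refine ⟨452 * poincareConst d, by positivity, ?_⟩
  intro r _ _ P _ _ _ abar _ a n p hp v Dv hv
  have h := a.isEllipticOn hd 0 n
  obtain ⟨S, hS⟩ := h.exists_isCellFamily (real_cube_pos _ _)
  have hae := hS.minimizer p v Dv hv
  set lam := ellInf a (cube 0 n)
  set Lam := ellSup a (cube 0 n)
  have hlam : 0 < lam := h.pos
  have hL : 0 < Lam := h.pos.trans_le h.le
  have hb := opNorm_nonneg abar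
  have hdef : 0 ≤ defect a abar n := sq_nonneg _
  constructor
  · rw [normHhat_congr (G := fun x => S p x - p) (by
      filter_upwards [hae] with x hx
      rw [hx])]
    refine (normHhat_gradient_sq_le hd h hS abar hp.le).trans (ENNReal.ofReal_le_ofReal ?_)
    calc _ ≤ 452 * poincareConst d *
          (Lam / lam + 3 ^ (2 * n) * (1 / lam) * defect a abar n) := by
          gcongr
          norm_num
      _ = _ := by ring
  · rw [normHhat_congr (G := fun x => app (a x) (S p x) - app abar p) (by
      filter_upwards [hae] with x hx
      rw [hx])]
    refine (normHhat_flux_sq_le hd h hS abar hp.le).trans (ENNReal.ofReal_le_ofReal ?_)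
    -- The flux bound was obtained with `Lam ^ 2` and `Lam`; since `lam ≤ Lam`, a factor `Lam / lam
    -- ≥ 1` can be inserted to reach the stated form.
    have h2 : Lam ^ 2 ≤ Lam ^ 3 / lam := by
      rw [le_div_iff₀ hlam, pow_succ Lam 2]
      exact mul_le_mul_of_nonneg_left h.le (by positivity)
    have h1 : Lam ≤ Lam ^ 2 / lam := by
      rw [le_div_iff₀ hlam, sq]
      exact mul_le_mul_of_nonneg_left h.le hL.le
    calc _ ≤ 113 * poincareConst d * (4 * (Lam ^ 3 / lam + opNorm abar ^ 2) +
          3 ^ (2 * n) * (4 * (Lam ^ 2 / lam + opNorm abar)) * defect a abar n) := by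
          gcongr
          norm_num
      _ = _ := by ring
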